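/- Let $C_1,C_2$ be real symmetric $3\times3$ matrices whose upper-left $2\times 2$ blocks are positive definite and with $\det C_1<0$, $\det C_2<0$. Assume that $C_1^{-1}C_2$ has three distinct positive eigenvalues $\lambda_1>\lambda_2>\lambda_3>0$, and that $\mathbf u^TC_1\mathbf u<0$ for every nonzero $\mathbf u\in\mathbb R^3$ with $\mathbf u^TC_2\mathbf u=0$. For a symmetric matrix $C$ put $\mathcal C(C)=\{(x,y)\in\mathbb R^2:\mathbf u^TC\mathbf u=0,\ \mathbf u=(x,y,1)^T\}$, and let $\mathcal C_1=\mathcal C(C_1)$ and $\mathcal C_{\boldsymbol\nu}=\mathcal C(\nu_1C_1+\nu_2C_2)$ for $\boldsymbol\nu=(\nu_1,\nu_2)$. Call $\boldsymbol\nu$ valid if $\nu_2>0$ and $\nu_1+\lambda_3\nu_2>0$; in this case $\mathcal C_{\boldsymbol\nu}$ is an ellipse inside the ellipse $\mathcal C_1$. For valid $\boldsymbol\nu$, the Poncelet map $P_{\boldsymbol\nu}:\mathcal C_1\to\mathcal C_1$ sends $z$ to the unique point $w\in\mathcal C_1$, $w\ne z$, such that the line from $z$ to $w$ is tangent to $\mathcal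 C_{\boldsymbol\nu}$ with $\mathcal C_{\boldsymbol\nu}$ on the left when moving from $z$ to $w$. Its rotation number is taken in $\mathbb R/\mathbb Z$, with respect to counterclockwise period-one parametrizations of $\mathcal C_1$. Let $e=\sqrt{\dfrac{\lambda_1-\lambda_2}{\lambda_1-\lambda_3}}$, let $F(\phi,e)=\int_0^\phi \dfrac{d\tau}{\sqrt{1-e^2\sin^2\tau}}$, $K(e)=F(\pi/2,e)$, and let $\mathrm{sn}(u,e)=\sin\phi$, $\mathrm{cn}(u,e)=\cos\phi$, where $F(\phi,e)=u$, be the Jacobi elliptic functions of modulus $e$. Then, for every $\ell\in(0,\tfrac12)$: 1. every $\boldsymbol\nu$ with $\nu_2>0$ on the ray $$\frac{\nu_1}{\nu_2}=\frac{\lambda_1\,\mathrm{cn}^2(2K(e)\ell,e)-\lambda_3}{\mathrm{sn}^2(2K(e)\ell,e)}\qquad(*)$$ is valid; 2. for every valid $\boldsymbol\nu$, the Poncelet map $P_{\boldsymbol\nu}$ is well defined (the point $w$ above exists and is unique for every $z\in\mathcal C_1$), and it has rotation number $\ell$ (modulo $1$) if and only if $(*)$ holds. -/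

import Mathlib

open scoped Matrix

noncomputable section

namespace Poncelet

/-- The quadratic form `uᵀ C u`. -/
def quadForm (C : Matrix (Fin 3) (Fin 3) ℝ) (u : Fin 3 → ℝ) : ℝ :=
  u ⬝ᵥ (C *ᵥ u)

/-- The plane curve `{(x, y) : uᵀ C u = 0, u = (x, y, 1)}` attached to the matrix `C`. -/
def conic (C : Matrix (Fin 3) (Fin 3) ℝ) : Set (ℝ × ℝ) :=
  {p | quadForm C ![p.1, p.2, 1] = 0}

/-- `C` is symmetric, its upper-left `2 × 2` block is positive definite and its determinant is
negative. -/
structure HasOrderedSignature (C : Matrix (Fin 3) (Fin 3) ℝ) : Prop where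
  isSymm : C.IsSymm
  pos : ∀ x y : ℝ, (x, y) ≠ (0, 0) → 0 < quadForm C ![x, y, 0]
  det_neg : C.det < 0

/-- `l₁ > l₂ > l₃ > 0` are the eigenvalues of the `3 × 3` matrix `A`. -/
structure HasOrderedEigenvalues (A : Matrix (Fin 3) (Fin 3) ℝ) (l₁ l₂ l₃ : ℝ) : Prop where
  eig₁ : Module.End.HasEigenvalue (Matrix.toLin' A) l₁
  eig₂ : Module.End.HasEigenvalue (Matrix.toLin' A) l₂
  eig₃ : Module.End.HasEigenvalue (Matrix.toLin' A) l₃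
  lt₁₂ : l₂ < l₁
  lt₂₃ : l₃ < l₂
  pos₃ : 0 < l₃

/-- The standing assumptions on a pair of nested ellipses, with `l₁ > l₂ > l₃ > 0` the three
positive, distinct eigenvalues of `C₁⁻¹ C₂`. -/
structure StandingAssumptions (C₁ C₂ : Matrix (Fin 3) (Fin 3) ℝ) (l₁ l₂ l₃ : ℝ) : Prop where
  signature₁ : HasOrderedSignature C₁
  signature₂ : HasOrderedSignature C₂
  eigenvalues : HasOrderedEigenvalues (C₁⁻¹ * C₂) l₁ l₂ l₃
  nested : ∀ u : Fin 3 → ℝ, u ≠ 0 → quadForm C₂ u = 0 → quadForm C₁ u < 0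

/-- The cone of valid pencil parameters. -/
def IsValidParameter (l₃ ν₁ ν₂ : ℝ) : Prop :=
  0 < ν₂ ∧ 0 < ν₁ + l₃ * ν₂

/-- The pencil eccentricity. -/
def pencilEccentricity (l₁ l₂ l₃ : ℝ) : ℝ :=
  √((l₁ - l₂) / (l₁ - l₃))

/-- The planar cross product (determinant) of two vectors. -/
def cross (v w : ℝ × ℝ) : ℝ :=
  v.1 * w.2 - v.2 * w.1

/-- The point `w ≠ z` lies on the outer ellipse `Co`, the line from `z` to `w` is tangent to the
ellipse `Ci` (it meets `Ci` in exactly one point), and `Ci` lies on the left when moving from `z`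
to `w`. -/
structure IsPonceletStep (Co Ci : Set (ℝ × ℝ)) (z w : ℝ × ℝ) : Prop where
  mem : w ∈ Co
  ne : w ≠ z
  tangent : ∃! p : ℝ × ℝ, p ∈ line[ℝ, z, w] ∧ p ∈ Ci
  left : ∀ p ∈ Ci, 0 ≤ cross (w - z) (p - z)

/-- The Poncelet map: `z ∈ Co` is sent to the point `w` with `IsPonceletStep Co Ci z w`. -/
def ponceletMap (Co Ci : Set (ℝ × ℝ)) (z : ℝ × ℝ) : ℝ × ℝ :=
  Classical.epsilon (IsPonceletStep Co Ci z)

/-- `γ` is a counterclockwise continuous parametrization with period `1` of the closed, strictly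
convex curve `C`: any three points met in this order within one period form a positively oriented
triangle (in particular `γ` is injective on `[0, 1)`). -/
structure IsPositiveParametrization (C : Set (ℝ × ℝ)) (γ : ℝ → ℝ × ℝ) : Prop where
  continuous : Continuous γ
  periodic : Function.Periodic γ 1
  range_eq : Set.range γ = C
  positive : ∀ a b c : ℝ, a < b → b < c → c < a + 1 → 0 < cross (γ b - γ a) (γ c - γ a)

/-- The circle map `P` of the curve `C` has rotation number `ρ ∈ ℝ / ℤ`: the limit of
`(Fⁿ x - x) / n` for a lift `F` of `P`, taken modulo `1`. -/
def HasRotationNumber (C : Set (ℝ × ℝ)) (P : ℝ × ℝ → ℝ × ℝ) (ρ : UnitAddCircle) : Prop :=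
  ∃ γ : ℝ → ℝ × ℝ, IsPositiveParametrization C γ ∧
    ∃ F : CircleDeg1Lift, Continuous F ∧ (∀ t, P (γ t) = γ (F t)) ∧
      ((F.translationNumber : ℝ) : UnitAddCircle) = ρ

/-- The incomplete elliptic integral of the first kind, with modulus `e`. -/
def ellipticF (φ e : ℝ) : ℝ :=
  ∫ τ in (0 : ℝ)..φ, 1 / √(1 - e ^ 2 * Real.sin τ ^ 2)

/-- The complete elliptic integral of the first kind. -/
def ellipticK (e : ℝ) : ℝ :=
  ellipticF (Real.pi / 2) e

/-- The Jacobi amplitude: for `0 ≤ e < 1` the inverse of the increasing bijection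
`φ ↦ ellipticF φ e` of `ℝ`. -/
def jacobiAm (u e : ℝ) : ℝ :=
  Function.invFun (fun φ => ellipticF φ e) u

/-- The Jacobi elliptic function `sn`, with modulus `e`. -/
def jacobiSn (u e : ℝ) : ℝ :=
  Real.sin (jacobiAm u e)

/-- The Jacobi elliptic function `cn`, with modulus `e`. -/
def jacobiCn (u e : ℝ) : ℝ :=
  Real.cos (jacobiAm u e)

/-- The slope `ν₁ / ν₂` of the ray of parameters with rotation number `ℓ`. -/
def inverseRatio (l₁ l₂ l₃ ℓ : ℝ) : ℝ :=
  (l₁ * jacobiCn (2 * ellipticK (pencilEccentricity l₁ l₂ l₃) * ℓ)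
      (pencilEccentricity l₁ l₂ l₃) ^ 2 - l₃) /
    jacobiSn (2 * ellipticK (pencilEccentricity l₁ l₂ l₃) * ℓ)
      (pencilEccentricity l₁ l₂ l₃) ^ 2

end Poncelet

end

/-! A common congruence turns `C₁` into the unit circle x² + y² = z² and the pencil member into a x²
+ b y² = c z², where a, b, c are ν₁ + lᵢ ν₂. The chord between angles φ₁, φ₂ is tangent to the
latter exactly when cos² m / a + sin² m / b = cos² d / c, with m the half-sum and d the
half-difference of the angles.

By `one_add_cos_jacobiAm_sub`, the angles am(u - v), am(u + v) satisfy this for every u as soon as a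
: b : c = 1 : dn² v : cn² v. The ray (*) says c = cn² v · a with v = 2Kℓ, and the choice of modulus
then makes b = dn² v · a automatic. So in the parameter u the Poncelet map is translation by 2v =
4Kℓ, that is, by ℓ once the period 4K is scaled to 1 (`isPonceletStep_jacobiParam`).

For the converse, every valid parameter lies on the ray of some ℓ' in (0, 1/2)
(`exists_eq_inverseRatio`), and the rotation number is independent of parametrization and lift
(`HasRotationNumber.unique`), so ℓ = ℓ'. -/

namespace Poncelet

/-! ### Elliptic integrals and identities for the Jacobi amplitude -/

/-- The elliptic delta amplitude `√(1 - e² sin² φ)`. -/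
noncomputable def ellipticDelta (φ e : ℝ) : ℝ :=
  √(1 - e ^ 2 * Real.sin φ ^ 2)

section Elliptic

variable {e : ℝ}

theorem one_sub_mul_sin_sq_pos (he : e ^ 2 < 1) (φ : ℝ) : 0 < 1 - e ^ 2 * Real.sin φ ^ 2 := by
  nlinarith [Real.sin_sq_le_one φ, sq_nonneg e, sq_nonneg (Real.sin φ)]

theorem ellipticDelta_pos (he : e ^ 2 < 1) (φ : ℝ) : 0 < ellipticDelta φ e :=
  Real.sqrt_pos.2 (one_sub_mul_sin_sq_pos he φ)

theorem ellipticDelta_sq (he : e ^ 2 < 1) (φ : ℝ) :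
    ellipticDelta φ e ^ 2 = 1 - e ^ 2 * Real.sin φ ^ 2 :=
  Real.sq_sqrt (one_sub_mul_sin_sq_pos he φ).le

theorem ellipticDelta_le_one (φ : ℝ) : ellipticDelta φ e ≤ 1 := by
  refine Real.sqrt_le_iff.2 ⟨zero_le_one, ?_⟩
  nlinarith [mul_nonneg (sq_nonneg e) (sq_nonneg (Real.sin φ))]

theorem hasDerivAt_ellipticDelta (he : e ^ 2 < 1) (φ : ℝ) :
    HasDerivAt (fun φ => ellipticDelta φ e)
      (-(e ^ 2 * Real.sin φ * Real.cos φ) / ellipticDelta φ e) φ := by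
  have h := ((((Real.hasDerivAt_sin φ).pow 2).const_mul (e ^ 2)).const_sub 1).sqrt
    (one_sub_mul_sin_sq_pos he φ).ne'
  refine h.congr_deriv ?_
  have h' := (ellipticDelta_pos he φ).ne'
  unfold ellipticDelta at *
  simp only [Pi.pow_apply]
  field_simp
  push_cast
  ring

theorem hasDerivAt_ellipticF (he : e ^ 2 < 1) (φ : ℝ) :
    HasDerivAt (fun φ => ellipticF φ e) (ellipticDelta φ e)⁻¹ φ := by
  have hc : Continuous fun τ : ℝ => 1 / √(1 - e ^ 2 * Real.sin τ ^ 2) :=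
    continuous_const.div (by fun_prop) fun τ => (ellipticDelta_pos he τ).ne'
  have h := (hc.integral_hasStrictDerivAt 0 φ).hasDerivAt
  simpa [ellipticF, ellipticDelta] using h

@[simp] theorem ellipticF_zero : ellipticF 0 e = 0 := by simp [ellipticF]

theorem continuous_ellipticF (he : e ^ 2 < 1) : Continuous fun φ => ellipticF φ e :=
  continuous_iff_continuousAt.2 fun φ => (hasDerivAt_ellipticF he φ).continuousAt

theorem strictMono_ellipticF (he : e ^ 2 < 1) : StrictMono fun φ => ellipticF φ e :=
  strictMono_of_deriv_pos fun φ => by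
    rw [(hasDerivAt_ellipticF he φ).deriv]
    exact inv_pos.2 (ellipticDelta_pos he φ)

/-- The integrand is at least 1. The resulting linear growth makes F unbounded in both directions.
-/
theorem monotone_ellipticF_sub (he : e ^ 2 < 1) : Monotone fun φ => ellipticF φ e - φ := by
  have h φ := (hasDerivAt_ellipticF he φ).sub (hasDerivAt_id φ)
  refine monotone_of_deriv_nonneg (fun φ => (h φ).differentiableAt) fun φ => ?_
  refine (h φ).deriv.symm ▸ sub_nonneg.2 ?_
  exact (one_le_inv₀ (ellipticDelta_pos he φ)).2 (ellipticDelta_le_one φ)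

theorem surjective_ellipticF (he : e ^ 2 < 1) : Function.Surjective fun φ => ellipticF φ e := by
  refine (continuous_ellipticF he).surjective ?_ ?_
  · refine Filter.tendsto_atTop_mono' _ ?_ Filter.tendsto_id
    filter_upwards [Filter.eventually_ge_atTop 0] with φ hφ
    simpa using monotone_ellipticF_sub he hφ
  · refine Filter.tendsto_atBot_mono' _ ?_ Filter.tendsto_id
    filter_upwards [Filter.eventually_le_atBot 0] with φ hφ
    simpa using monotone_ellipticF_sub he hφ

theorem ellipticF_neg (he : e ^ 2 < 1) (φ : ℝ) : ellipticF (-φ) e = -ellipticF φ e := by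
  have h φ := ((hasDerivAt_ellipticF he (-φ)).comp φ (hasDerivAt_neg φ)).add
    (hasDerivAt_ellipticF he φ)
  have := is_const_of_deriv_eq_zero (fun φ => (h φ).differentiableAt)
    (fun φ => by rw [(h φ).deriv]; simp [ellipticDelta]) φ 0
  simp at this
  linarith

/-- The integrand has period π, so the increment is constant; at φ = -π/2 oddness shows that it is
2K. -/
theorem ellipticF_add_pi (he : e ^ 2 < 1) (φ : ℝ) :
    ellipticF (φ + Real.pi) e = ellipticF φ e + 2 * ellipticK e := by
  have h φ := ((hasDerivAt_ellipticF he (φ + Real.pi)).comp_add_const φ Real.pi).sub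
    (hasDerivAt_ellipticF he φ)
  have hc := is_const_of_deriv_eq_zero (fun φ => (h φ).differentiableAt)
    (fun φ => by rw [(h φ).deriv]; simp [ellipticDelta])
  have h₁ := hc φ (-(Real.pi / 2))
  simp only [Pi.sub_apply, ellipticF_neg he, neg_add_eq_sub, sub_half] at h₁
  unfold ellipticK
  linarith

/-- Surjectivity of F, and injectivity for the next lemma, make `invFun` a genuine inverse rather
than a default value. -/
theorem ellipticF_jacobiAm (he : e ^ 2 < 1) (u : ℝ) : ellipticF (jacobiAm u e) e = u :=
  Function.rightInverse_invFun (surjective_ellipticF he) u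

theorem jacobiAm_ellipticF (he : e ^ 2 < 1) (φ : ℝ) : jacobiAm (ellipticF φ e) e = φ :=
  Function.leftInverse_invFun (strictMono_ellipticF he).injective φ

theorem strictMono_jacobiAm (he : e ^ 2 < 1) : StrictMono fun u => jacobiAm u e := by
  intro u v huv
  rw [← ellipticF_jacobiAm he u, ← ellipticF_jacobiAm he v] at huv
  exact (strictMono_ellipticF he).lt_iff_lt.1 huv

theorem surjective_jacobiAm (he : e ^ 2 < 1) : Function.Surjective fun u => jacobiAm u e :=
  fun φ => ⟨_, jacobiAm_ellipticF he φ⟩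

theorem continuous_jacobiAm (he : e ^ 2 < 1) : Continuous fun u => jacobiAm u e :=
  (strictMono_jacobiAm he).monotone.continuous_of_surjective (surjective_jacobiAm he)

theorem hasDerivAt_jacobiAm (he : e ^ 2 < 1) (u : ℝ) :
    HasDerivAt (fun u => jacobiAm u e) (ellipticDelta (jacobiAm u e) e) u := by
  have h := HasDerivAt.of_local_left_inverse (continuous_jacobiAm he).continuousAt
    (hasDerivAt_ellipticF he (jacobiAm u e)) (inv_ne_zero (ellipticDelta_pos he _).ne')
    (Filter.Eventually.of_forall fun v => ellipticF_jacobiAm he v)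
  simpa using h

theorem jacobiAm_zero (he : e ^ 2 < 1) : jacobiAm 0 e = 0 := by
  simpa using jacobiAm_ellipticF he 0

theorem jacobiAm_ellipticK (he : e ^ 2 < 1) : jacobiAm (ellipticK e) e = Real.pi / 2 :=
  jacobiAm_ellipticF he _

theorem jacobiAm_neg (he : e ^ 2 < 1) (u : ℝ) : jacobiAm (-u) e = -jacobiAm u e := by
  apply (strictMono_ellipticF he).injective
  simp only [ellipticF_neg he, ellipticF_jacobiAm he]

theorem jacobiAm_add_two_mul_ellipticK (he : e ^ 2 < 1) (u : ℝ) :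
    jacobiAm (u + 2 * ellipticK e) e = jacobiAm u e + Real.pi := by
  apply (strictMono_ellipticF he).injective
  simp only [ellipticF_add_pi he, ellipticF_jacobiAm he]

theorem ellipticK_pos (he : e ^ 2 < 1) : 0 < ellipticK e := by
  have := strictMono_ellipticF he Real.pi_div_two_pos
  simpa [ellipticK] using this

theorem jacobiAm_mem_Ioo (he : e ^ 2 < 1) {v : ℝ} (h₀ : 0 < v) (h₁ : v < ellipticK e) :
    jacobiAm v e ∈ Set.Ioo 0 (Real.pi / 2) := by
  have h₂ := strictMono_jacobiAm he h₀
  have h₃ := strictMono_jacobiAm he h₁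
  simp only [jacobiAm_zero he, jacobiAm_ellipticK he] at h₂ h₃
  exact ⟨h₂, h₃⟩

theorem jacobiAm_sub_mem_Ioo (he : e ^ 2 < 1) {v : ℝ} (h₀ : 0 < v) (h₁ : v < ellipticK e)
    (u : ℝ) : jacobiAm (u + v) e - jacobiAm (u - v) e ∈ Set.Ioo 0 Real.pi := by
  have h₂ := strictMono_jacobiAm he (show u - v < u + v by linarith)
  have h₃ := strictMono_jacobiAm he (show u + v < u - v + 2 * ellipticK e by linarith)
  simp only [jacobiAm_add_two_mul_ellipticK he] at h₂ h₃
  constructor <;> linarith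

theorem hasDerivAt_ellipticDelta_jacobiAm (he : e ^ 2 < 1) (u : ℝ) :
    HasDerivAt (fun u => ellipticDelta (jacobiAm u e) e)
      (-(e ^ 2 * Real.sin (jacobiAm u e) * Real.cos (jacobiAm u e))) u := by
  have h := (hasDerivAt_ellipticDelta he (jacobiAm u e)).comp u (hasDerivAt_jacobiAm he u)
  rw [div_mul_cancel₀ _ (ellipticDelta_pos he _).ne'] at h
  exact h

/-- The sum of the delta amplitudes at `u + v` and `u - v` is proportional to the sine of the
difference of the amplitudes. -/
theorem ellipticDelta_add_eq_mul_sin (he : e ^ 2 < 1) {v : ℝ} (h₀ : 0 < v)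
    (h₁ : v < ellipticK e) (u : ℝ) :
    Real.sin (jacobiAm v e) * Real.cos (jacobiAm v e) *
        (ellipticDelta (jacobiAm (u + v) e) e + ellipticDelta (jacobiAm (u - v) e) e) =
      ellipticDelta (jacobiAm v e) e * Real.sin (jacobiAm (u + v) e - jacobiAm (u - v) e) := by
  have hs (u : ℝ) : Real.sin (jacobiAm (u + v) e - jacobiAm (u - v) e) ≠ 0 :=
    (Real.sin_pos_of_mem_Ioo (jacobiAm_sub_mem_Ioo he h₀ h₁ u)).ne'
  -- The quotient of the sum of the deltas by the sine of the amplitude difference has zero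
  -- derivative in u; the claim compares its values at u and at 0.
  have h (u : ℝ) :=
    (((hasDerivAt_ellipticDelta_jacobiAm he (u + v)).comp_add_const u v).add
      ((hasDerivAt_ellipticDelta_jacobiAm he (u - v)).comp_sub_const u v)).div
    (((hasDerivAt_jacobiAm he (u + v)).comp_add_const u v).sub
      ((hasDerivAt_jacobiAm he (u - v)).comp_sub_const u v)).sin (hs u)
  have hc := is_const_of_deriv_eq_zero (fun u => (h u).differentiableAt) (fun u => by
    rw [(h u).deriv, div_eq_zero_iff]
    left
    simp only [Pi.add_apply, Pi.sub_apply]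
    have d₁ := ellipticDelta_sq he (jacobiAm (u + v) e)
    have d₂ := ellipticDelta_sq he (jacobiAm (u - v) e)
    have t₁ := Real.sin_sq_add_cos_sq (jacobiAm (u + v) e)
    have t₂ := Real.sin_sq_add_cos_sq (jacobiAm (u - v) e)
    rw [Real.sin_sub, Real.cos_sub]
    generalize Real.sin (jacobiAm (u + v) e) = s₁ at *
    generalize Real.sin (jacobiAm (u - v) e) = s₂ at *
    generalize Real.cos (jacobiAm (u + v) e) = c₁ at *
    generalize Real.cos (jacobiAm (u - v) e) = c₂ at *
    linear_combination (c₁ * c₂ + s₁ * s₂) * (d₂ - d₁) - e ^ 2 * s₁ * s₂ * (t₂ - t₁)) u 0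
  simp only [Pi.add_apply, Pi.sub_apply, Pi.div_apply] at hc
  have hs₀ := hs 0
  rw [div_eq_div_iff (hs u) (hs 0)] at hc
  simp only [zero_add, zero_sub, jacobiAm_neg he, sub_neg_eq_add] at hc hs₀
  have hd : ellipticDelta (-jacobiAm v e) e = ellipticDelta (jacobiAm v e) e := by
    simp [ellipticDelta]
  rw [hd, ← two_mul (jacobiAm v e), Real.sin_two_mul] at hc
  linarith

/-- The cosines of the sum and of the difference of the amplitudes at `u + v` and `u - v` are
related by an affine equation that depends on `v` only. -/
theorem one_add_cos_jacobiAm_sub (he : e ^ 2 < 1) {v : ℝ} (h₀ : 0 < v)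
    (h₁ : v < ellipticK e) (u : ℝ) :
    ellipticDelta (jacobiAm v e) e ^ 2 *
        (1 + Real.cos (jacobiAm (u + v) e - jacobiAm (u - v) e)) =
      Real.cos (jacobiAm v e) ^ 2 * ellipticDelta (jacobiAm v e) e ^ 2 *
        (1 + Real.cos (jacobiAm (u + v) e + jacobiAm (u - v) e)) +
      Real.cos (jacobiAm v e) ^ 2 *
        (1 - Real.cos (jacobiAm (u + v) e + jacobiAm (u - v) e)) := by
  -- With s, c, D the sine, cosine and delta at am v, the combination D² cos(difference) + e² s² c²
  -- cos(sum) is constant in u.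
  have h (u : ℝ) :=
    ((((hasDerivAt_jacobiAm he (u + v)).comp_add_const u v).sub
      ((hasDerivAt_jacobiAm he (u - v)).comp_sub_const u v)).cos.const_mul
        (ellipticDelta (jacobiAm v e) e ^ 2)).add
    ((((hasDerivAt_jacobiAm he (u + v)).comp_add_const u v).add
      ((hasDerivAt_jacobiAm he (u - v)).comp_sub_const u v)).cos.const_mul
        (e ^ 2 * Real.sin (jacobiAm v e) ^ 2 * Real.cos (jacobiAm v e) ^ 2))
  have hc := is_const_of_deriv_eq_zero (fun u => (h u).differentiableAt) (fun u => by
    rw [(h u).deriv]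
    simp only [Pi.add_apply, Pi.sub_apply]
    have hA := ellipticDelta_add_eq_mul_sin he h₀ h₁ u
    have hp := add_pos (ellipticDelta_pos he (jacobiAm (u + v) e))
      (ellipticDelta_pos he (jacobiAm (u - v) e))
    have d₁ := ellipticDelta_sq he (jacobiAm (u + v) e)
    have d₂ := ellipticDelta_sq he (jacobiAm (u - v) e)
    have hss : Real.sin (jacobiAm (u + v) e + jacobiAm (u - v) e) *
        Real.sin (jacobiAm (u + v) e - jacobiAm (u - v) e) =
        Real.sin (jacobiAm (u + v) e) ^ 2 - Real.sin (jacobiAm (u - v) e) ^ 2 := by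
      rw [Real.sin_add, Real.sin_sub]
      have t₁ := Real.sin_sq_add_cos_sq (jacobiAm (u + v) e)
      have t₂ := Real.sin_sq_add_cos_sq (jacobiAm (u - v) e)
      linear_combination Real.sin (jacobiAm (u + v) e) ^ 2 * t₂ -
        Real.sin (jacobiAm (u - v) e) ^ 2 * t₁
    generalize Real.sin (jacobiAm (u + v) e + jacobiAm (u - v) e) = P at *
    generalize Real.sin (jacobiAm (u + v) e - jacobiAm (u - v) e) = Q at *
    generalize ellipticDelta (jacobiAm (u + v) e) e = D₁ at *
    generalize ellipticDelta (jacobiAm (u - v) e) e = D₂ at *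
    generalize ellipticDelta (jacobiAm v e) e = D at *
    -- The positive factor D₁ + D₂ turns D₁ - D₂ into a difference of squares, rational in the
    -- sines, and lets `hA` enter squared.
    refine (mul_eq_zero.1 (?_ : (D₁ + D₂) * _ = 0)).resolve_left hp.ne'
    generalize Real.sin (jacobiAm v e) = s at *
    generalize Real.cos (jacobiAm v e) = c at *
    linear_combination -D ^ 2 * Q * (d₁ - d₂) - e ^ 2 * P * (s * c * (D₁ + D₂) + D * Q) * hA
      - e ^ 2 * D ^ 2 * Q * hss) u 0
  simp only [Pi.add_apply, Pi.sub_apply, zero_add, zero_sub, jacobiAm_neg he, sub_neg_eq_add,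
    add_neg_cancel, Real.cos_zero] at hc
  rw [← two_mul (jacobiAm v e), Real.cos_two_mul] at hc
  have d := ellipticDelta_sq he (jacobiAm v e)
  generalize ellipticDelta (jacobiAm v e) e = D at *
  generalize Real.sin (jacobiAm v e) = s at *
  generalize Real.cos (jacobiAm v e) = c at *
  linear_combination hc + (1 - Real.cos (jacobiAm (u + v) e + jacobiAm (u - v) e)) * c ^ 2 * d

end Elliptic

/-! ### Quadratic forms and the diagonalizing frame -/

theorem quadForm_smul (C : Matrix (Fin 3) (Fin 3) ℝ) (k : ℝ) (u : Fin 3 → ℝ) :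
    quadForm C (k • u) = k ^ 2 * quadForm C u := by
  simp only [quadForm, Matrix.mulVec_smul, smul_dotProduct, dotProduct_smul, smul_eq_mul]
  ring

theorem quadForm_pencil (C₁ C₂ : Matrix (Fin 3) (Fin 3) ℝ) (ν₁ ν₂ : ℝ) (u : Fin 3 → ℝ) :
    quadForm (ν₁ • C₁ + ν₂ • C₂) u = ν₁ * quadForm C₁ u + ν₂ * quadForm C₂ u := by
  simp [quadForm, Matrix.add_mulVec, Matrix.smul_mulVec]

theorem quadForm_mulVec (C V : Matrix (Fin 3) (Fin 3) ℝ) (x : Fin 3 → ℝ) :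
    quadForm C (V *ᵥ x) = quadForm (Vᵀ * C * V) x := by
  simp only [quadForm, ← Matrix.mulVec_mulVec, Matrix.mulVec_transpose]
  rw [← Matrix.vecMul_transpose, ← Matrix.dotProduct_mulVec, Matrix.vecMul_transpose,
    Matrix.mulVec_transpose]

theorem quadForm_diagonal (d x : Fin 3 → ℝ) :
    quadForm (Matrix.diagonal d) x = d 0 * x 0 ^ 2 + d 1 * x 1 ^ 2 + d 2 * x 2 ^ 2 := by
  simp only [quadForm, dotProduct, Fin.sum_univ_three, Matrix.mulVec_diagonal]
  ring

/-- Two symmetric matrices of which the first is invertible are diagonalized by a common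
congruence when their quotient has three distinct real eigenvalues. -/
theorem exists_simultaneous_diagonalization {C₁ C₂ : Matrix (Fin 3) (Fin 3) ℝ}
    (h₁ : C₁.IsSymm) (h₂ : C₂.IsSymm) (hdet : C₁.det ≠ 0) {l : Fin 3 → ℝ}
    (hl : Function.Injective l)
    (heig : ∀ i, Module.End.HasEigenvalue (Matrix.toLin' (C₁⁻¹ * C₂)) (l i)) :
    ∃ (V : Matrix (Fin 3) (Fin 3) ℝ) (d : Fin 3 → ℝ), V.det ≠ 0 ∧
      (Vᵀ * C₁ * V = Matrix.diagonal d) ∧ Vᵀ * C₂ * V = Matrix.diagonal (d * l) := by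
  choose w hw using fun i => (heig i).exists_hasEigenvector
  have hli := Module.End.eigenvectors_linearIndependent' _ l hl w hw
  set V : Matrix (Fin 3) (Fin 3) ℝ := (Matrix.of w)ᵀ with hV
  have hVdet : V.det ≠ 0 := by
    have : IsUnit V := Matrix.linearIndependent_cols_iff_isUnit.1 hli
    exact ((Matrix.isUnit_iff_isUnit_det V).1 this).ne_zero
  have hAV : C₁⁻¹ * C₂ * V = V * Matrix.diagonal l := by
    ext i j
    have := congrFun (hw j).apply_eq_smul i
    rw [Matrix.toLin'_apply] at this
    rw [Matrix.mul_diagonal]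
    simpa [Matrix.mul_apply, Matrix.mulVec, dotProduct, hV, mul_comm] using this
  have hC₂V : C₂ * V = C₁ * V * Matrix.diagonal l := by
    rw [Matrix.mul_assoc, ← hAV, Matrix.mul_assoc, Matrix.mul_nonsing_inv_cancel_left]
    exact isUnit_iff_ne_zero.2 hdet
  have hM₂ : Vᵀ * C₂ * V = Vᵀ * C₁ * V * Matrix.diagonal l := by
    rw [Matrix.mul_assoc, hC₂V]
    simp only [Matrix.mul_assoc]
  have hs₁ : (Vᵀ * C₁ * V)ᵀ = Vᵀ * C₁ * V := by
    simp [Matrix.transpose_mul, h₁.eq, Matrix.mul_assoc]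
  have hs₂ : (Vᵀ * C₂ * V)ᵀ = Vᵀ * C₂ * V := by
    simp [Matrix.transpose_mul, h₂.eq, Matrix.mul_assoc]
  set M := Vᵀ * C₁ * V
  -- Both M and M · diag(l) are symmetric, so M i j · l j = M i j · l i, and distinctness of the l i
  -- kills the off-diagonal entries.
  have hM : M = Matrix.diagonal fun i => M i i := by
    ext i j
    rcases eq_or_ne i j with rfl | hij
    · simp
    rw [Matrix.diagonal_apply_ne _ hij]
    have e := congrFun (congrFun hs₂ i) j
    have e₁ := congrFun (congrFun hs₁ i) j
    rw [hM₂, Matrix.transpose_apply, Matrix.mul_diagonal, Matrix.mul_diagonal] at e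
    rw [Matrix.transpose_apply] at e₁
    rw [e₁] at e
    by_contra hne
    exact hij (hl (mul_left_cancel₀ hne e))
  refine ⟨V, fun i => M i i, hVdet, hM, ?_⟩
  rw [hM₂]
  conv_lhs => rw [hM]
  rw [Matrix.diagonal_mul_diagonal]
  rfl

/-- A frame in which the pencil spanned by `C₁` and `C₂` is diagonal, `C₁` is the unit circle, and
which is orientation preserving on the closed disc bounded by `C₁`. -/
structure IsPencilFrame (C₁ C₂ S : Matrix (Fin 3) (Fin 3) ℝ) (l₁ l₂ l₃ : ℝ) : Prop where
  quadForm₁ : ∀ x, quadForm C₁ (S *ᵥ x) = x 0 ^ 2 + x 1 ^ 2 - x 2 ^ 2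
  quadForm₂ : ∀ x, quadForm C₂ (S *ᵥ x) = l₁ * x 0 ^ 2 + l₂ * x 1 ^ 2 - l₃ * x 2 ^ 2
  det_pos : 0 < S.det
  pos : ∀ x, 0 < x 2 → x 0 ^ 2 + x 1 ^ 2 ≤ x 2 ^ 2 → 0 < (S *ᵥ x) 2

/-- Normalizing a diagonal entry leaves the sign of the scaling free; the sign is spent on
orientation and on the choice of affine chart. -/
theorem exists_sq_mul_eq_one {d k : ℝ} (hd : 0 < d) (hk : k ≠ 0) :
    ∃ s : ℝ, s ^ 2 * d = 1 ∧ 0 < k * s := by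
  have hs : (√d)⁻¹ ^ 2 * d = 1 := by
    rw [inv_pow, Real.sq_sqrt hd.le, inv_mul_cancel₀ hd.ne']
  have hp : 0 < (√d)⁻¹ := inv_pos.2 (Real.sqrt_pos.2 hd)
  rcases hk.lt_or_gt with hk | hk
  · exact ⟨-(√d)⁻¹, by rw [neg_sq, hs], by nlinarith⟩
  · exact ⟨(√d)⁻¹, hs, by positivity⟩

/-- The form is positive definite at infinity, so the solid cone where it is nonpositive meets the
plane u₂ = 0 only at the origin. -/
theorem HasOrderedSignature.eq_zero_of_quadForm_nonpos {C : Matrix (Fin 3) (Fin 3) ℝ}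
    (h : HasOrderedSignature C) {u : Fin 3 → ℝ} (hu : u 2 = 0) (hq : quadForm C u ≤ 0) :
    u = 0 := by
  have hu' : u = ![u 0, u 1, 0] := by
    ext i; fin_cases i <;> simp [hu]
  have h₀ : (u 0, u 1) = ((0 : ℝ), (0 : ℝ)) := by
    by_contra hne
    have := h.pos _ _ hne
    rw [← hu'] at this
    linarith
  rw [Prod.mk.injEq] at h₀
  rw [hu', h₀.1, h₀.2]
  simp

theorem StandingAssumptions.exists_isPencilFrame {C₁ C₂ : Matrix (Fin 3) (Fin 3) ℝ}
    {l₁ l₂ l₃ : ℝ} (h : StandingAssumptions C₁ C₂ l₁ l₂ l₃) :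
    ∃ S, IsPencilFrame C₁ C₂ S l₁ l₂ l₃ := by
  have h₁₂ := h.eigenvalues.lt₁₂
  have h₂₃ := h.eigenvalues.lt₂₃
  have h₃ := h.eigenvalues.pos₃
  have hl : Function.Injective ![l₁, l₂, l₃] := by
    intro i j hij
    fin_cases i <;> fin_cases j <;> simp at hij ⊢ <;> linarith
  obtain ⟨V, d, hV, hV₁, hV₂⟩ := exists_simultaneous_diagonalization h.signature₁.isSymm
    h.signature₂.isSymm h.signature₁.det_neg.ne hl (by
      intro i
      fin_cases i
      exacts [h.eigenvalues.eig₁, h.eigenvalues.eig₂, h.eigenvalues.eig₃])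
  have q₁ (x) : quadForm C₁ (V *ᵥ x) = d 0 * x 0 ^ 2 + d 1 * x 1 ^ 2 + d 2 * x 2 ^ 2 := by
    rw [quadForm_mulVec, hV₁, quadForm_diagonal]
  have q₂ (x) : quadForm C₂ (V *ᵥ x) =
      d 0 * l₁ * x 0 ^ 2 + d 1 * l₂ * x 1 ^ 2 + d 2 * l₃ * x 2 ^ 2 := by
    rw [quadForm_mulVec, hV₂, quadForm_diagonal]
    simp
  have hinj {x : Fin 3 → ℝ} (hx : V *ᵥ x = 0) : x = 0 :=
    Matrix.eq_zero_of_mulVec_eq_zero hV hx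
  have hd : d 0 * d 1 * d 2 < 0 := by
    have := congrArg Matrix.det hV₁
    rw [Matrix.det_mul, Matrix.det_mul, Matrix.det_transpose, Matrix.det_diagonal,
      Fin.prod_univ_three] at this
    rw [← this]
    have := mul_pos_of_neg_of_neg h.signature₁.det_neg (neg_lt_zero.2 (pow_pos (abs_pos.2 hV) 2))
    rw [sq_abs] at this
    linarith
  have hn (x : Fin 3 → ℝ) (hx : x ≠ 0)
      (h₀ : d 0 * l₁ * x 0 ^ 2 + d 1 * l₂ * x 1 ^ 2 + d 2 * l₃ * x 2 ^ 2 = 0) :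
      d 0 * x 0 ^ 2 + d 1 * x 1 ^ 2 + d 2 * x 2 ^ 2 < 0 := by
    rw [← q₁]
    exact h.nested _ (fun h => hx (hinj h)) (by rw [q₂, h₀])
  -- The determinant forces an odd number of negative signs. Nestedness excludes (-,+,+) and
  -- (+,-,+), and positivity of the upper-left block excludes (-,-,-).
  have hsign : 0 < d 0 ∧ 0 < d 1 ∧ d 2 < 0 := by
    have hd₁ : d 1 ≠ 0 := by rintro h; simp [h] at hd
    have hd₂ : d 2 ≠ 0 := by rintro h; simp [h] at hd
    -- The test vector is isotropic for `C₂`, while `C₁` takes the value d₀ d₁ (l₂ - l₁) > 0 on it,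
    -- against nestedness. `h12` is the same in the last two coordinates.
    have h01 : ¬ (d 0 < 0 ∧ 0 < d 1) := by
      rintro ⟨ha, hb⟩
      have hA : 0 < d 1 * l₂ := mul_pos hb (by linarith)
      have hB : 0 < -(d 0 * l₁) := by nlinarith
      have := hn ![√(d 1 * l₂), √(-(d 0 * l₁)), 0]
        (fun h => (Real.sqrt_pos.2 hA).ne' (by simpa using congrFun h 0))
        (by simp [Real.sq_sqrt hA.le, Real.sq_sqrt hB.le]; ring)
      simp [Real.sq_sqrt hA.le, Real.sq_sqrt hB.le] at this
      nlinarith [mul_pos (neg_pos.2 ha) hb]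
    have h12 : ¬ (d 1 < 0 ∧ 0 < d 2) := by
      rintro ⟨ha, hb⟩
      have hA : 0 < d 2 * l₃ := mul_pos hb (by linarith)
      have hB : 0 < -(d 1 * l₂) := by nlinarith
      have := hn ![0, √(d 2 * l₃), √(-(d 1 * l₂))]
        (fun h => (Real.sqrt_pos.2 hA).ne' (by simpa using congrFun h 1))
        (by simp [Real.sq_sqrt hA.le, Real.sq_sqrt hB.le]; ring)
      simp [Real.sq_sqrt hA.le, Real.sq_sqrt hB.le] at this
      nlinarith [mul_pos (neg_pos.2 ha) hb]
    have hneg : ¬ (d 0 < 0 ∧ d 1 < 0 ∧ d 2 < 0) := by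
      rintro ⟨ha, hb, hc⟩
      have hpos := h.signature₁.pos 1 0 (by simp)
      have hVx : V *ᵥ (V⁻¹ *ᵥ ![1, 0, 0]) = ![1, 0, 0] := by
        rw [Matrix.mulVec_mulVec, Matrix.mul_nonsing_inv _ (isUnit_iff_ne_zero.2 hV),
          Matrix.one_mulVec]
      rw [← hVx, q₁] at hpos
      nlinarith [sq_nonneg ((V⁻¹ *ᵥ ![1, 0, 0]) 0), sq_nonneg ((V⁻¹ *ᵥ ![1, 0, 0]) 1),
        sq_nonneg ((V⁻¹ *ᵥ ![1, 0, 0]) 2)]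
    have hd₀ : d 0 ≠ 0 := by rintro h; simp [h] at hd
    rcases hd₀.lt_or_gt with ha | ha <;> rcases hd₁.lt_or_gt with hb | hb <;>
      rcases hd₂.lt_or_gt with hc | hc
    · exact absurd ⟨ha, hb, hc⟩ hneg
    · exact absurd ⟨hb, hc⟩ h12
    · exact absurd ⟨ha, hb⟩ h01
    · exact absurd ⟨ha, hb⟩ h01
    · linarith [mul_pos_of_neg_of_neg (mul_neg_of_pos_of_neg ha hb) hc]
    · exact absurd ⟨hb, hc⟩ h12
    · exact ⟨ha, hb, hc⟩
    · linarith [mul_pos (mul_pos ha hb) hc]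
  obtain ⟨hd₀, hd₁, hd₂⟩ := hsign
  have hV22 : V 2 2 ≠ 0 := by
    intro hz
    have := h.signature₁.eq_zero_of_quadForm_nonpos (u := V *ᵥ ![0, 0, 1])
      (by simpa [Matrix.mulVec, dotProduct, Fin.sum_univ_three] using hz)
      (by rw [q₁]; simp; exact hd₂.le)
    simpa using congrFun (hinj this) 2
  -- The sign of s₂ makes the last diagonal entry of the frame positive; the sign of s₀ then makes
  -- its determinant positive.
  obtain ⟨s₂, hs₂, hs₂'⟩ := exists_sq_mul_eq_one (neg_pos.2 hd₂) hV22
  obtain ⟨s₁, hs₁, hs₁'⟩ := exists_sq_mul_eq_one hd₁ one_ne_zero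
  obtain ⟨s₀, hs₀, hs₀'⟩ := exists_sq_mul_eq_one hd₀ (k := V.det * (s₁ * s₂)) (by
    have : s₂ ≠ 0 := right_ne_zero_of_mul hs₂'.ne'
    have : s₁ ≠ 0 := right_ne_zero_of_mul hs₁'.ne'
    positivity)
  have hS (x : Fin 3 → ℝ) : (V * Matrix.diagonal ![s₀, s₁, s₂]) *ᵥ x =
      V *ᵥ ![s₀ * x 0, s₁ * x 1, s₂ * x 2] := by
    rw [← Matrix.mulVec_mulVec]
    congr 1
    ext i
    rw [Matrix.mulVec_diagonal]
    fin_cases i <;> rfl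
  have Q₁ (x : Fin 3 → ℝ) : quadForm C₁ ((V * Matrix.diagonal ![s₀, s₁, s₂]) *ᵥ x) =
      x 0 ^ 2 + x 1 ^ 2 - x 2 ^ 2 := by
    rw [hS, q₁]
    simp only [Matrix.cons_val]
    linear_combination x 0 ^ 2 * hs₀ + x 1 ^ 2 * hs₁ - x 2 ^ 2 * hs₂
  have hdet : (V * Matrix.diagonal ![s₀, s₁, s₂]).det = V.det * (s₁ * s₂) * s₀ := by
    rw [Matrix.det_mul, Matrix.det_diagonal, Fin.prod_univ_three]
    simp only [Matrix.cons_val]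
    ring
  have hdet' : 0 < (V * Matrix.diagonal ![s₀, s₁, s₂]).det := hdet ▸ hs₀'
  refine ⟨V * Matrix.diagonal ![s₀, s₁, s₂], Q₁, ?_, hdet', ?_⟩
  · intro x
    rw [hS, q₂]
    simp only [Matrix.cons_val]
    linear_combination l₁ * x 0 ^ 2 * hs₀ + l₂ * x 1 ^ 2 * hs₁ - l₃ * x 2 ^ 2 * hs₂
  · intro x hx hx'
    by_contra! hle
    have h22 : (V * Matrix.diagonal ![s₀, s₁, s₂]) 2 2 = V 2 2 * s₂ := by
      rw [Matrix.mul_diagonal]; rfl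
    generalize V * Matrix.diagonal ![s₀, s₁, s₂] = S at *
    rw [← h22] at hs₂'
    -- Raising the third coordinate of x by t ≥ 0 stays in the solid cone and brings the image to
    -- the plane at infinity. The raised vector must then vanish, although its third coordinate is
    -- positive.
    have ht : 0 ≤ -((S *ᵥ x) 2) / S 2 2 := div_nonneg (by linarith) hs₂'.le
    set t := -((S *ᵥ x) 2) / S 2 2
    have hz : (S *ᵥ (x + ![0, 0, t])) 2 = 0 := by
      have : S 2 2 * t = -((S *ᵥ x) 2) := mul_div_cancel₀ _ hs₂'.ne'
      rw [Matrix.mulVec_add]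
      simp only [Pi.add_apply]
      simp [Matrix.mulVec, dotProduct, Fin.sum_univ_three] at this ⊢
      linarith
    have h0 := h.signature₁.eq_zero_of_quadForm_nonpos hz (by
      rw [Q₁]
      simp
      nlinarith)
    have := congrFun (Matrix.eq_zero_of_mulVec_eq_zero hdet'.ne' h0) 2
    simp at this
    linarith

/-! ### Positive parametrizations and uniqueness of the rotation number -/

theorem cross_swap (v w : ℝ × ℝ) : cross v w = -cross w v := by simp [cross]; ring

namespace IsPositiveParametrization

variable {C : Set (ℝ × ℝ)} {γ γ' : ℝ → ℝ × ℝ}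

theorem map_add_int (hγ : IsPositiveParametrization C γ) (t : ℝ) (n : ℤ) : γ (t + n) = γ t := by
  simpa using hγ.periodic.int_mul n t

theorem map_sub_int (hγ : IsPositiveParametrization C γ) (t : ℝ) (n : ℤ) : γ (t - n) = γ t := by
  simpa using hγ.periodic.sub_int_mul_eq (x := t) n

theorem map_ne (hγ : IsPositiveParametrization C γ) {a b : ℝ} (hab : a < b) (hb : b < a + 1) :
    γ a ≠ γ b := by
  intro h
  obtain ⟨c, hbc, hc⟩ := exists_between hb
  have := hγ.positive a b c hab hbc hc
  simp [h, cross] at this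

theorem exists_int_of_eq (hγ : IsPositiveParametrization C γ) {a b : ℝ} (h : γ a = γ b) :
    ∃ n : ℤ, b = a + n := by
  refine ⟨⌊b - a⌋, ?_⟩
  have h₁ := Int.floor_le (b - a)
  have h₂ := Int.lt_floor_add_one (b - a)
  by_contra hne
  have h₃ : a < b - ⌊b - a⌋ := lt_of_le_of_ne (by linarith) fun h => hne (by linarith)
  exact hγ.map_ne h₃ (by linarith) (by rw [hγ.map_sub_int, h])

theorem exists_mem_Ico (hγ : IsPositiveParametrization C γ) (s : ℝ) {p : ℝ × ℝ} (hp : p ∈ C) :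
    ∃ t ∈ Set.Ico s (s + 1), γ t = p := by
  rw [← hγ.range_eq] at hp
  obtain ⟨t, rfl⟩ := hp
  refine ⟨t - ⌊t - s⌋, ⟨?_, ?_⟩, hγ.map_sub_int _ _⟩
  · linarith [Int.floor_le (t - s)]
  · linarith [Int.lt_floor_add_one (t - s)]

/-- Two counterclockwise parametrizations of a curve differ by a continuous change of
parameter of degree one. -/
theorem exists_lift (hγ : IsPositiveParametrization C γ) (hγ' : IsPositiveParametrization C γ') :
    ∃ h : CircleDeg1Lift, Continuous h ∧ ∀ t, γ' t = γ (h t) := by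
  have hmem (t : ℝ) : γ' t ∈ C := hγ'.range_eq ▸ Set.mem_range_self t
  obtain ⟨s, -, hs⟩ := hγ.exists_mem_Ico 0 (hmem 0)
  choose g hg hgγ using fun t => hγ.exists_mem_Ico s (hmem t)
  have hg₀ : g 0 = s := by
    by_contra hne
    exact hγ.map_ne (lt_of_le_of_ne (hg 0).1 (Ne.symm hne)) (hg 0).2 (by rw [hs, hgγ])
  -- A reversal of order would give one triangle both orientations.
  have hmono : ∀ a b : ℝ, 0 ≤ a → a ≤ b → b < 1 → g a ≤ g b := by
    intro a b ha hab hb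
    rcases ha.eq_or_lt with rfl | ha
    · exact hg₀ ▸ (hg b).1
    rcases hab.eq_or_lt with rfl | hab
    · exact le_rfl
    by_contra! hlt
    have h₁ := hγ'.positive 0 a b ha hab (by linarith)
    rw [← hs, ← hgγ a, ← hgγ b, cross_swap] at h₁
    have h₂ : s ≠ g b := fun h => by simp [← h, cross] at h₁
    have h₃ := hγ.positive s (g b) (g a) (lt_of_le_of_ne (hg b).1 h₂) hlt (hg a).2
    linarith
  have hmono' : Monotone fun t : ℝ => g (Int.fract t) + ⌊t⌋ := by
    intro a b hab
    have hfl := Int.floor_mono hab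
    rcases hfl.eq_or_lt with heq | hlt
    · have hab' : Int.fract a ≤ Int.fract b := by
        rw [Int.fract, Int.fract, heq]; linarith
      have := hmono _ _ (Int.fract_nonneg a) hab' (Int.fract_lt_one b)
      simp only [heq]; linarith
    · have h₁ : (⌊a⌋ : ℝ) + 1 ≤ ⌊b⌋ := by exact_mod_cast hlt
      have h₂ := (hg (Int.fract a)).2
      have h₃ := (hg (Int.fract b)).1
      simp only; linarith
  have hconj (t : ℝ) : γ' t = γ (g (Int.fract t) + ⌊t⌋) := by
    rw [hγ.map_add_int, hgγ, Int.fract, hγ'.map_sub_int]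
  let h : CircleDeg1Lift := ⟨⟨_, hmono'⟩, fun t => by simp [add_assoc]⟩
  -- A monotone degree-one lift is continuous once it is onto, and this follows from the equality of
  -- the two ranges.
  refine ⟨h, h.continuous_iff_surjective.2 fun r => ?_, hconj⟩
  have hr : γ r ∈ Set.range γ' := by rw [hγ'.range_eq, ← hγ.range_eq]; exact ⟨r, rfl⟩
  obtain ⟨t, ht⟩ := hr
  obtain ⟨n, hn⟩ := hγ.exists_int_of_eq (ht.symm.trans (hconj t))
  refine ⟨t - n, ?_⟩
  rw [h.map_sub_int]
  exact sub_eq_iff_eq_add.2 hn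

end IsPositiveParametrization

/-- The change of parameter g carries one lift to the other up to an integer n(t). Continuity makes
n constant, so g semiconjugates an integer translate of F' to F, and the translation numbers differ
by an integer. -/
theorem HasRotationNumber.unique {C : Set (ℝ × ℝ)} {P : ℝ × ℝ → ℝ × ℝ} {ρ ρ' : UnitAddCircle}
    (h : HasRotationNumber C P ρ) (h' : HasRotationNumber C P ρ') : ρ = ρ' := by
  obtain ⟨γ, hγ, F, hF, hPF, rfl⟩ := h
  obtain ⟨γ', hγ', F', hF', hPF', rfl⟩ := h'
  obtain ⟨g, hg, hgγ⟩ := hγ.exists_lift hγ'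
  have hint (t : ℝ) : ∃ n : ℤ, F (g t) = g (F' t) + n :=
    hγ.exists_int_of_eq (by rw [← hgγ, ← hPF', ← hPF, ← hgγ])
  choose n hn using hint
  have hcont : Continuous fun t => (n t : ℝ) := by
    have : (fun t => (n t : ℝ)) = fun t => F (g t) - g (F' t) := by
      funext t; rw [hn]; ring
    rw [this]
    exact (hF.comp hg).sub (hg.comp hF')
  have hconst (t : ℝ) : n t = n 0 :=
    PreconnectedSpace.constant inferInstance
      (Int.isClosedEmbedding_coe_real.isInducing.continuous_iff.2 hcont)
  have hsemi : Function.Semiconj g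
      (CircleDeg1Lift.translate (Multiplicative.ofAdd (n 0 : ℝ)) * F' : CircleDeg1Lift) F := by
    intro t
    rw [CircleDeg1Lift.mul_apply, CircleDeg1Lift.translate_apply, g.map_int_add, hn, hconst t,
      add_comm]
  rw [← CircleDeg1Lift.translationNumber_eq_of_semiconj hsemi,
    CircleDeg1Lift.translationNumber_mul_of_commute,
    CircleDeg1Lift.translationNumber_translate]
  · rw [AddCircle.coe_add, add_eq_right]
    exact (AddCircle.coe_eq_zero_iff 1).2 ⟨n 0, by simp⟩
  · rw [CircleDeg1Lift.commute_iff_commute]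
    intro t
    simp [CircleDeg1Lift.translate_apply]

/-! ### Affine points, chords and the unit circle -/

/-- The affine point with homogeneous coordinates `u`. -/
noncomputable def affinePoint (u : Fin 3 → ℝ) : ℝ × ℝ :=
  (u 0 / u 2, u 1 / u 2)

theorem affinePoint_homogeneous {u : Fin 3 → ℝ} (hu : u 2 ≠ 0) :
    ![(affinePoint u).1, (affinePoint u).2, 1] = (u 2)⁻¹ • u := by
  ext i
  fin_cases i <;> simp [affinePoint, div_eq_inv_mul, hu]

theorem affinePoint_mem_conic {C : Matrix (Fin 3) (Fin 3) ℝ} {u : Fin 3 → ℝ} (hu : u 2 ≠ 0) :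
    affinePoint u ∈ conic C ↔ quadForm C u = 0 := by
  simp [conic, affinePoint_homogeneous hu, quadForm_smul, hu]

/-- The determinant of three vectors in `ℝ³`. -/
def triple (u v w : Fin 3 → ℝ) : ℝ :=
  u 0 * (v 1 * w 2 - v 2 * w 1) - u 1 * (v 0 * w 2 - v 2 * w 0) + u 2 * (v 0 * w 1 - v 1 * w 0)

theorem triple_mulVec (S : Matrix (Fin 3) (Fin 3) ℝ) (x y z : Fin 3 → ℝ) :
    triple (S *ᵥ x) (S *ᵥ y) (S *ᵥ z) = S.det * triple x y z := by
  simp only [triple, Matrix.det_fin_three, Matrix.mulVec, dotProduct, Fin.sum_univ_three]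
  ring

theorem cross_affinePoint {u v w : Fin 3 → ℝ} (hu : u 2 ≠ 0) (hv : v 2 ≠ 0) (hw : w 2 ≠ 0) :
    cross (affinePoint v - affinePoint u) (affinePoint w - affinePoint u) =
      triple u v w / (u 2 * v 2 * w 2) := by
  simp only [cross, affinePoint, triple, Prod.fst_sub, Prod.snd_sub]
  field_simp
  ring

theorem quadForm_line (C : Matrix (Fin 3) (Fin 3) ℝ) (z v : ℝ × ℝ) :
    ∃ L : ℝ, ∀ t : ℝ, quadForm C ![z.1 + t * v.1, z.2 + t * v.2, 1] =
      quadForm C ![z.1, z.2, 1] + t * L + t ^ 2 * quadForm C ![v.1, v.2, 0] := by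
  refine ⟨![z.1, z.2, 1] ⬝ᵥ (C *ᵥ ![v.1, v.2, 0]) + ![v.1, v.2, 0] ⬝ᵥ (C *ᵥ ![z.1, z.2, 1]),
    fun t => ?_⟩
  simp only [quadForm, Matrix.mulVec, dotProduct, Fin.sum_univ_three, Matrix.cons_val]
  ring

theorem mem_line_iff {z w p : ℝ × ℝ} : p ∈ line[ℝ, z, w] ↔
    ∃ t : ℝ, p = (z.1 + t * (w - z).1, z.2 + t * (w - z).2) := by
  rw [mem_affineSpan_pair_iff_exists_lineMap_eq]
  refine exists_congr fun t => ?_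
  rw [eq_comm]
  simp [AffineMap.lineMap_apply, Prod.ext_iff, add_comm]

/-- On a chord `z w` of an ellipse the quadratic form is a multiple of `t (t - 1)`. -/
theorem HasOrderedSignature.quadForm_chord {C : Matrix (Fin 3) (Fin 3) ℝ}
    (hC : HasOrderedSignature C) {z w : ℝ × ℝ} (hz : z ∈ conic C) (hw : w ∈ conic C)
    (hne : w ≠ z) :
    ∃ k > 0, ∀ t : ℝ, quadForm C ![z.1 + t * (w - z).1, z.2 + t * (w - z).2, 1] =
      k * (t * (t - 1)) := by
  obtain ⟨L, hL⟩ := quadForm_line C z (w - z)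
  have h₁ := hL 1
  have hz' : quadForm C ![z.1, z.2, 1] = 0 := hz
  have hw' : quadForm C ![w.1, w.2, 1] = 0 := hw
  refine ⟨_, hC.pos (w - z).1 (w - z).2 (sub_ne_zero.2 hne), fun t => ?_⟩
  simp only [Prod.fst_sub, Prod.snd_sub, one_mul, add_sub_cancel, hz', hw'] at h₁
  rw [hL, hz']
  simp only [Prod.fst_sub, Prod.snd_sub]
  linear_combination -t * h₁

/-- Each contact point is interior to `C`, hence lies ahead of z on its chord, and is on the left of
the other chord. So the cross product of the two directions has both signs and vanishes, and the
common line meets `C` only once besides z. -/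
theorem IsPonceletStep.unique {C : Matrix (Fin 3) (Fin 3) ℝ} (hC : HasOrderedSignature C)
    {Ci : Set (ℝ × ℝ)} (hCi : ∀ p ∈ Ci, quadForm C ![p.1, p.2, 1] < 0) {z w w' : ℝ × ℝ}
    (hz : z ∈ conic C) (h : IsPonceletStep (conic C) Ci z w)
    (h' : IsPonceletStep (conic C) Ci z w') : w = w' := by
  obtain ⟨k, hk, hkt⟩ := hC.quadForm_chord hz h.mem h.ne
  obtain ⟨k', hk', hkt'⟩ := hC.quadForm_chord hz h'.mem h'.ne
  obtain ⟨p, ⟨hp, hpi⟩, -⟩ := h.tangent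
  obtain ⟨p', ⟨hp', hpi'⟩, -⟩ := h'.tangent
  obtain ⟨t, rfl⟩ := mem_line_iff.1 hp
  obtain ⟨t', rfl⟩ := mem_line_iff.1 hp'
  have ht := hCi _ hpi
  have ht' := hCi _ hpi'
  rw [hkt] at ht
  rw [hkt'] at ht'
  have ht₀ : 0 < t := by
    by_contra! hle
    nlinarith [mul_nonneg hk.le (mul_nonneg_of_nonpos_of_nonpos hle (by linarith : t - 1 ≤ 0))]
  have ht₀' : 0 < t' := by
    by_contra! hle
    nlinarith [mul_nonneg hk'.le (mul_nonneg_of_nonpos_of_nonpos hle (by linarith : t' - 1 ≤ 0))]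
  have hl := h'.left _ hpi
  have hl' := h.left _ hpi'
  have e : cross (w' - z) ((z.1 + t * (w - z).1, z.2 + t * (w - z).2) - z) =
      t * -cross (w - z) (w' - z) := by
    simp [cross]; ring
  have e' : cross (w - z) ((z.1 + t' * (w' - z).1, z.2 + t' * (w' - z).2) - z) =
      t' * cross (w - z) (w' - z) := by
    simp [cross]; ring
  rw [e] at hl
  rw [e'] at hl'
  have h₀ : cross (w - z) (w' - z) = 0 :=
    le_antisymm (by linarith [nonneg_of_mul_nonneg_right hl ht₀])
      (nonneg_of_mul_nonneg_right hl' ht₀')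
  obtain ⟨s, hs⟩ : ∃ s : ℝ, w' = (z.1 + s * (w - z).1, z.2 + s * (w - z).2) := by
    have hv : (w - z).1 ≠ 0 ∨ (w - z).2 ≠ 0 := by
      by_contra! hv
      exact h.ne (sub_eq_zero.1 (Prod.ext hv.1 hv.2))
    simp only [cross] at h₀
    rcases hv with hv | hv
    · refine ⟨(w' - z).1 / (w - z).1, Prod.ext ?_ ?_⟩
      · rw [div_mul_cancel₀ _ hv]; simp
      · simp only [div_mul_eq_mul_div]
        rw [← sub_eq_iff_eq_add', eq_div_iff hv]
        simp at h₀ ⊢; linarith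
    · refine ⟨(w' - z).2 / (w - z).2, Prod.ext ?_ ?_⟩
      · simp only [div_mul_eq_mul_div]
        rw [← sub_eq_iff_eq_add', eq_div_iff hv]
        simp at h₀ ⊢; linarith
      · rw [div_mul_cancel₀ _ hv]; simp
  have hmem : quadForm C ![w'.1, w'.2, 1] = 0 := h'.mem
  rw [hs, hkt] at hmem
  rcases mul_eq_zero.1 ((mul_eq_zero.1 hmem).resolve_left hk.ne') with h0 | h1
  · exact absurd (by rw [hs, h0]; simp) h'.ne
  · rw [hs, sub_eq_zero.1 h1]; simp

/-- The point of the unit circle at angle `φ`, in homogeneous coordinates. -/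
noncomputable def circleVec (φ : ℝ) : Fin 3 → ℝ :=
  ![Real.cos φ, Real.sin φ, 1]

/-- This is the normal form cos m · x + sin m · y = cos d of the chord, which brings in the half-sum
and half-difference of the angles. -/
theorem triple_circleVec (φ₁ φ₂ : ℝ) (x : Fin 3 → ℝ) :
    triple (circleVec φ₁) (circleVec φ₂) x =
      2 * Real.sin ((φ₂ - φ₁) / 2) * (Real.cos ((φ₂ - φ₁) / 2) * x 2 -
        (Real.cos ((φ₂ + φ₁) / 2) * x 0 + Real.sin ((φ₂ + φ₁) / 2) * x 1)) := by
  have h₁ : φ₁ = (φ₂ + φ₁) / 2 - (φ₂ - φ₁) / 2 := by ring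
  have h₂ : φ₂ = (φ₂ + φ₁) / 2 + (φ₂ - φ₁) / 2 := by ring
  generalize (φ₂ + φ₁) / 2 = m at *
  generalize (φ₂ - φ₁) / 2 = d at *
  subst h₁
  rw [h₂]
  simp only [triple, circleVec, Matrix.cons_val, Real.cos_add, Real.sin_add, Real.cos_sub,
    Real.sin_sub]
  have := Real.sin_sq_add_cos_sq m
  linear_combination 2 * Real.sin d * Real.cos d * x 2 * this

theorem triple_circleVec_pos {a b c : ℝ} (hab : a < b) (hbc : b < c)
    (hc : c < a + 2 * Real.pi) :
    0 < triple (circleVec a) (circleVec b) (circleVec c) := by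
  have h : triple (circleVec a) (circleVec b) (circleVec c) =
      4 * Real.sin ((b - a) / 2) * Real.sin ((c - b) / 2) * Real.sin ((c - a) / 2) := by
    have h₁ : Real.cos ((b + a) / 2) * Real.cos c + Real.sin ((b + a) / 2) * Real.sin c =
        Real.cos ((c - b) / 2 + (c - a) / 2) := by
      rw [← Real.cos_sub, ← Real.cos_neg]; congr 1; ring
    have h₂ : (b - a) / 2 = (c - a) / 2 - (c - b) / 2 := by ring
    rw [triple_circleVec]
    simp only [circleVec, Matrix.cons_val]
    rw [h₁, h₂, Real.cos_sub, Real.cos_add]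
    ring
  rw [h]
  have s₁ : 0 < Real.sin ((b - a) / 2) := Real.sin_pos_of_pos_of_lt_pi (by linarith) (by linarith)
  have s₂ : 0 < Real.sin ((c - b) / 2) := Real.sin_pos_of_pos_of_lt_pi (by linarith) (by linarith)
  have s₃ : 0 < Real.sin ((c - a) / 2) := Real.sin_pos_of_pos_of_lt_pi (by linarith) (by linarith)
  positivity

/-! ### The pencil in the frame: nesting, tangency and orientation -/

section Frame

variable {C₁ C₂ S : Matrix (Fin 3) (Fin 3) ℝ} {l₁ l₂ l₃ : ℝ}

namespace IsPencilFrame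

theorem circleVec_pos (hS : IsPencilFrame C₁ C₂ S l₁ l₂ l₃) (φ : ℝ) :
    0 < (S *ᵥ circleVec φ) 2 :=
  hS.pos _ (by simp [circleVec]) (by simp [circleVec])

theorem circlePoint_mem (hS : IsPencilFrame C₁ C₂ S l₁ l₂ l₃) (φ : ℝ) :
    affinePoint (S *ᵥ circleVec φ) ∈ conic C₁ := by
  rw [affinePoint_mem_conic (hS.circleVec_pos φ).ne', hS.quadForm₁]
  simp [circleVec]

theorem exists_coordinates (hS : IsPencilFrame C₁ C₂ S l₁ l₂ l₃) {p : ℝ × ℝ}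
    (hp : quadForm C₁ ![p.1, p.2, 1] ≤ 0) :
    ∃ x : Fin 3 → ℝ, S *ᵥ x = ![p.1, p.2, 1] ∧ 0 < x 2 ∧ x 0 ^ 2 + x 1 ^ 2 ≤ x 2 ^ 2 := by
  obtain ⟨x, hx⟩ : ∃ x, S *ᵥ x = ![p.1, p.2, 1] :=
    ⟨S⁻¹ *ᵥ ![p.1, p.2, 1], by
      rw [Matrix.mulVec_mulVec, Matrix.mul_nonsing_inv _ (isUnit_iff_ne_zero.2 hS.det_pos.ne'),
        Matrix.one_mulVec]⟩
  rw [← hx, hS.quadForm₁] at hp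
  refine ⟨x, hx, ?_, by linarith⟩
  by_contra! hle
  rcases hle.eq_or_lt with h₀ | hlt
  · rw [h₀] at hp
    have h0 : x 0 = 0 := by nlinarith [sq_nonneg (x 0), sq_nonneg (x 1)]
    have h1 : x 1 = 0 := by nlinarith [sq_nonneg (x 0), sq_nonneg (x 1)]
    have : x = 0 := by ext i; fin_cases i <;> assumption
    simpa [this] using congrFun hx 2
  · have := hS.pos (-x) (by simpa using hlt) (by simpa using hp)
    rw [Matrix.mulVec_neg, hx] at this
    simp at this
    linarith

theorem exists_circlePoint_eq (hS : IsPencilFrame C₁ C₂ S l₁ l₂ l₃) {p : ℝ × ℝ}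
    (hp : p ∈ conic C₁) : ∃ φ, affinePoint (S *ᵥ circleVec φ) = p := by
  obtain ⟨x, hx, hx₂, -⟩ := hS.exists_coordinates (le_of_eq hp)
  have hq : quadForm C₁ ![p.1, p.2, 1] = 0 := hp
  rw [← hx, hS.quadForm₁] at hq
  have hc : (x 0 / x 2) ^ 2 + (x 1 / x 2) ^ 2 = 1 := by
    field_simp
    linarith
  have hn : ‖(⟨x 0 / x 2, x 1 / x 2⟩ : ℂ)‖ = 1 := by
    rw [← sq_eq_sq₀ (norm_nonneg _) zero_le_one, Complex.sq_norm, Complex.normSq_apply]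
    linarith
  refine ⟨Complex.arg ⟨x 0 / x 2, x 1 / x 2⟩, ?_⟩
  have hvec : circleVec (Complex.arg ⟨x 0 / x 2, x 1 / x 2⟩) = (x 2)⁻¹ • x := by
    rw [circleVec, Complex.cos_arg (norm_ne_zero_iff.1 (hn ▸ one_ne_zero)), Complex.sin_arg, hn]
    ext i
    fin_cases i <;> simp [div_eq_inv_mul, hx₂.ne']
  rw [hvec, Matrix.mulVec_smul, hx]
  ext <;> simp [affinePoint] <;> field_simp

theorem cross_circlePoint (hS : IsPencilFrame C₁ C₂ S l₁ l₂ l₃) (φ₁ φ₂ : ℝ) {x : Fin 3 → ℝ}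
    (hx : 0 < (S *ᵥ x) 2) :
    ∃ k > 0, cross (affinePoint (S *ᵥ circleVec φ₂) - affinePoint (S *ᵥ circleVec φ₁))
      (affinePoint (S *ᵥ x) - affinePoint (S *ᵥ circleVec φ₁)) =
        k * triple (circleVec φ₁) (circleVec φ₂) x := by
  have h₁ := hS.circleVec_pos φ₁
  have h₂ := hS.circleVec_pos φ₂
  refine ⟨S.det / ((S *ᵥ circleVec φ₁) 2 * (S *ᵥ circleVec φ₂) 2 * (S *ᵥ x) 2),
    div_pos hS.det_pos (by positivity), ?_⟩
  rw [cross_affinePoint h₁.ne' h₂.ne' hx.ne', triple_mulVec]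
  ring

theorem quadForm_pencil (hS : IsPencilFrame C₁ C₂ S l₁ l₂ l₃) (ν₁ ν₂ : ℝ) (x : Fin 3 → ℝ) :
    quadForm (ν₁ • C₁ + ν₂ • C₂) (S *ᵥ x) = (ν₁ + l₁ * ν₂) * x 0 ^ 2 +
      (ν₁ + l₂ * ν₂) * x 1 ^ 2 - (ν₁ + l₃ * ν₂) * x 2 ^ 2 := by
  rw [Poncelet.quadForm_pencil, hS.quadForm₁, hS.quadForm₂]
  ring

/-- In the frame the pencil member is (ν₁ + l₃ ν₂) times `C₁` plus nonnegative multiples of x₀² and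
x₁². If it vanishes where `C₁` is nonnegative, all coordinates are zero. -/
theorem quadForm_neg (hS : IsPencilFrame C₁ C₂ S l₁ l₂ l₃) {ν₁ ν₂ : ℝ}
    (h₁₂ : l₂ < l₁) (h₂₃ : l₃ < l₂) (hν : IsValidParameter l₃ ν₁ ν₂) {p : ℝ × ℝ}
    (hp : p ∈ conic (ν₁ • C₁ + ν₂ • C₂)) : quadForm C₁ ![p.1, p.2, 1] < 0 := by
  obtain ⟨x, hx⟩ : ∃ x, S *ᵥ x = ![p.1, p.2, 1] :=
    ⟨S⁻¹ *ᵥ ![p.1, p.2, 1], by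
      rw [Matrix.mulVec_mulVec, Matrix.mul_nonsing_inv _ (isUnit_iff_ne_zero.2 hS.det_pos.ne'),
        Matrix.one_mulVec]⟩
  have hp' : quadForm (ν₁ • C₁ + ν₂ • C₂) ![p.1, p.2, 1] = 0 := hp
  rw [← hx, hS.quadForm_pencil] at hp'
  rw [← hx, hS.quadForm₁]
  obtain ⟨hν₂, hc⟩ := hν
  have e₁ : 0 < (l₁ - l₃) * ν₂ := mul_pos (by linarith) hν₂
  have e₂ : 0 < (l₂ - l₃) * ν₂ := mul_pos (by linarith) hν₂
  by_contra! hle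
  have h₁ := mul_nonneg hc.le hle
  have h0 : x 0 ^ 2 = 0 := by
    have := mul_nonneg e₁.le (sq_nonneg (x 0))
    have := mul_nonneg e₂.le (sq_nonneg (x 1))
    have : (l₁ - l₃) * ν₂ * x 0 ^ 2 = 0 := by nlinarith
    exact (mul_eq_zero.1 this).resolve_left e₁.ne'
  have h1 : x 1 ^ 2 = 0 := by
    have := mul_nonneg e₂.le (sq_nonneg (x 1))
    have : (l₂ - l₃) * ν₂ * x 1 ^ 2 = 0 := by nlinarith
    exact (mul_eq_zero.1 this).resolve_left e₂.ne'
  rw [h0, h1] at hle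
  have h2 : x 2 ^ 2 = 0 := by nlinarith [sq_nonneg (x 2)]
  have : x = 0 := by
    ext i
    fin_cases i
    exacts [pow_eq_zero_iff two_ne_zero |>.1 h0, pow_eq_zero_iff two_ne_zero |>.1 h1,
      pow_eq_zero_iff two_ne_zero |>.1 h2]
  simpa [this] using congrFun hx 2

theorem mul_quadForm_le (hS : IsPencilFrame C₁ C₂ S l₁ l₂ l₃) {ν₁ ν₂ : ℝ}
    (h₁₂ : l₂ < l₁) (h₂₃ : l₃ < l₂) (hν₂ : 0 < ν₂) (x : Fin 3 → ℝ) :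
    (ν₁ + l₃ * ν₂) * quadForm C₁ (S *ᵥ x) ≤ quadForm (ν₁ • C₁ + ν₂ • C₂) (S *ᵥ x) := by
  rw [hS.quadForm_pencil, hS.quadForm₁]
  have e₁ := mul_nonneg (mul_pos (sub_pos.2 (h₂₃.trans h₁₂)) hν₂).le (sq_nonneg (x 0))
  have e₂ := mul_nonneg (mul_pos (sub_pos.2 h₂₃) hν₂).le (sq_nonneg (x 1))
  nlinarith

/-- The discriminant of the pencil member on the chord of the unit circle between two angles. -/
theorem discrim_chord {a b c φ₁ φ₂ : ℝ}
    (h : b * c * (1 + Real.cos (φ₂ + φ₁)) + a * c * (1 - Real.cos (φ₂ + φ₁)) =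
      a * b * (1 + Real.cos (φ₂ - φ₁))) :
    (a * Real.cos φ₁ * Real.cos φ₂ + b * Real.sin φ₁ * Real.sin φ₂ - c) ^ 2 =
      (a * Real.cos φ₁ ^ 2 + b * Real.sin φ₁ ^ 2 - c) *
        (a * Real.cos φ₂ ^ 2 + b * Real.sin φ₂ ^ 2 - c) := by
  rw [Real.cos_add, Real.cos_sub] at h
  have t₁ := Real.sin_sq_add_cos_sq φ₁
  have t₂ := Real.sin_sq_add_cos_sq φ₂
  generalize Real.cos φ₁ = c₁ at *
  generalize Real.cos φ₂ = c₂ at *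
  generalize Real.sin φ₁ = s₁ at *
  generalize Real.sin φ₂ = s₂ at *
  -- The discriminant is, up to sign, a combination of these three squares; each has the factor 1 -
  -- cos(φ₂ - φ₁), and the cofactors form exactly the tangency equation.
  have k₁ : (s₁ - s₂) ^ 2 = (1 - (c₂ * c₁ + s₂ * s₁)) * (1 + (c₂ * c₁ - s₂ * s₁)) := by
    linear_combination t₁ * c₂ ^ 2 + t₂ * (1 - s₁ ^ 2)
  have k₂ : (c₁ - c₂) ^ 2 = (1 - (c₂ * c₁ + s₂ * s₁)) * (1 - (c₂ * c₁ - s₂ * s₁)) := by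
    linear_combination t₁ * s₂ ^ 2 + t₂ * (1 - c₁ ^ 2)
  have k₃ : (s₂ * c₁ - c₂ * s₁) ^ 2 =
      (1 - (c₂ * c₁ + s₂ * s₁)) * (1 + (c₂ * c₁ + s₂ * s₁)) := by
    linear_combination t₁ * (s₂ ^ 2 + c₂ ^ 2) + t₂
  linear_combination b * c * k₁ + a * c * k₂ - a * b * k₃ + (1 - (c₂ * c₁ + s₂ * s₁)) * h

/-- Along the chord the pencil form is a quadratic in t with positive leading coefficient and zero
discriminant, hence has exactly one root. -/
theorem existsUnique_tangent (hS : IsPencilFrame C₁ C₂ S l₁ l₂ l₃)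
    (hC₁ : HasOrderedSignature C₁) {ν₁ ν₂ : ℝ}
    (h₁₂ : l₂ < l₁) (h₂₃ : l₃ < l₂) (hν : IsValidParameter l₃ ν₁ ν₂) {φ₁ φ₂ : ℝ}
    (hne : affinePoint (S *ᵥ circleVec φ₂) ≠ affinePoint (S *ᵥ circleVec φ₁))
    (htan : (ν₁ + l₂ * ν₂) * (ν₁ + l₃ * ν₂) * (1 + Real.cos (φ₂ + φ₁)) +
      (ν₁ + l₁ * ν₂) * (ν₁ + l₃ * ν₂) * (1 - Real.cos (φ₂ + φ₁)) =
        (ν₁ + l₁ * ν₂) * (ν₁ + l₂ * ν₂) * (1 + Real.cos (φ₂ - φ₁))) :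
    ∃! p : ℝ × ℝ, p ∈ line[ℝ, affinePoint (S *ᵥ circleVec φ₁), affinePoint (S *ᵥ circleVec φ₂)] ∧
      p ∈ conic (ν₁ • C₁ + ν₂ • C₂) := by
  have w₁ := (hS.circleVec_pos φ₁).ne'
  have w₂ := (hS.circleVec_pos φ₂).ne'
  set z := affinePoint (S *ᵥ circleVec φ₁) with hz
  set w := affinePoint (S *ᵥ circleVec φ₂) with hw
  have hz' := affinePoint_homogeneous w₁
  have hw' := affinePoint_homogeneous w₂
  rw [← hz] at hz'
  rw [← hw] at hw'
  generalize (S *ᵥ circleVec φ₁) 2 = r₁ at *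
  generalize (S *ᵥ circleVec φ₂) 2 = r₂ at *
  rw [← Matrix.mulVec_smul] at hz' hw'
  have hdisc := discrim_chord htan
  have hv : ![(w - z).1, (w - z).2, 0] = S *ᵥ (r₂⁻¹ • circleVec φ₂ - r₁⁻¹ • circleVec φ₁) := by
    rw [Matrix.mulVec_sub, ← hz', ← hw']
    ext i; fin_cases i <;> simp
  have hpt (t : ℝ) : ![z.1 + t * (w - z).1, z.2 + t * (w - z).2, 1] =
      S *ᵥ (r₁⁻¹ • circleVec φ₁ + t • (r₂⁻¹ • circleVec φ₂ - r₁⁻¹ • circleVec φ₁)) := by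
    rw [Matrix.mulVec_add, Matrix.mulVec_smul S t, ← hv, ← hz']
    ext i; fin_cases i <;> simp
  have hA : 0 < quadForm (ν₁ • C₁ + ν₂ • C₂) ![(w - z).1, (w - z).2, 0] := by
    have := hC₁.pos (w - z).1 (w - z).2 (sub_ne_zero.2 hne)
    rw [hv] at this ⊢
    exact (mul_pos hν.2 this).trans_le (hS.mul_quadForm_le h₁₂ h₂₃ hν.1 _)
  rw [hv, hS.quadForm_pencil] at hA
  obtain ⟨A, B, D, hA, hD, hq⟩ : ∃ A B D : ℝ, 0 < A ∧ B ^ 2 = A * D ∧ ∀ t : ℝ,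
      quadForm (ν₁ • C₁ + ν₂ • C₂) ![z.1 + t * (w - z).1, z.2 + t * (w - z).2, 1] =
        A * t ^ 2 - 2 * B * t + D := by
    have hq (t : ℝ) := hS.quadForm_pencil ν₁ ν₂
      (r₁⁻¹ • circleVec φ₁ + t • (r₂⁻¹ • circleVec φ₂ - r₁⁻¹ • circleVec φ₁))
    simp only [circleVec, Pi.add_apply, Pi.sub_apply, Pi.smul_apply, smul_eq_mul,
      Matrix.cons_val] at hA hq
    refine ⟨_, r₁⁻¹ ^ 2 * ((ν₁ + l₁ * ν₂) * Real.cos φ₁ ^ 2 +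
        (ν₁ + l₂ * ν₂) * Real.sin φ₁ ^ 2 - (ν₁ + l₃ * ν₂)) -
        r₁⁻¹ * r₂⁻¹ * ((ν₁ + l₁ * ν₂) * Real.cos φ₁ * Real.cos φ₂ +
        (ν₁ + l₂ * ν₂) * Real.sin φ₁ * Real.sin φ₂ - (ν₁ + l₃ * ν₂)),
      r₁⁻¹ ^ 2 * ((ν₁ + l₁ * ν₂) * Real.cos φ₁ ^ 2 +
        (ν₁ + l₂ * ν₂) * Real.sin φ₁ ^ 2 - (ν₁ + l₃ * ν₂)), hA, ?_, fun t => ?_⟩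
    · linear_combination r₁⁻¹ ^ 2 * r₂⁻¹ ^ 2 * hdisc
    · rw [hpt]
      simp only [circleVec]
      rw [hq]
      ring
  have hroot (t : ℝ) : A * t ^ 2 - 2 * B * t + D = 0 ↔ t = B / A := by
    rw [eq_div_iff hA.ne', ← sub_eq_zero (b := B), ← sq_eq_zero_iff (a := t * A - B)]
    have : (t * A - B) ^ 2 = A * (A * t ^ 2 - 2 * B * t + D) := by linear_combination hD
    rw [this, mul_eq_zero, or_iff_right hA.ne']
  refine ⟨(z.1 + B / A * (w - z).1, z.2 + B / A * (w - z).2),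
    ⟨mem_line_iff.2 ⟨_, rfl⟩, ((hq _).trans ((hroot _).2 rfl) :)⟩, ?_⟩
  rintro p ⟨hp, hp'⟩
  obtain ⟨t, rfl⟩ := mem_line_iff.1 hp
  rw [(hroot t).1 ((hq t).symm.trans hp')]

/-- If the chord between two points of the outer conic satisfies the tangency equation, then its
endpoints form a Poncelet step. -/
theorem isPonceletStep (hS : IsPencilFrame C₁ C₂ S l₁ l₂ l₃)
    (hC₁ : HasOrderedSignature C₁) {ν₁ ν₂ : ℝ}
    (h₁₂ : l₂ < l₁) (h₂₃ : l₃ < l₂) (hν : IsValidParameter l₃ ν₁ ν₂) {φ₁ φ₂ : ℝ}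
    (hφ : φ₂ - φ₁ ∈ Set.Ioo 0 Real.pi)
    (htan : (ν₁ + l₂ * ν₂) * (ν₁ + l₃ * ν₂) * (1 + Real.cos (φ₂ + φ₁)) +
      (ν₁ + l₁ * ν₂) * (ν₁ + l₃ * ν₂) * (1 - Real.cos (φ₂ + φ₁)) =
        (ν₁ + l₁ * ν₂) * (ν₁ + l₂ * ν₂) * (1 + Real.cos (φ₂ - φ₁))) :
    IsPonceletStep (conic C₁) (conic (ν₁ • C₁ + ν₂ • C₂))
      (affinePoint (S *ᵥ circleVec φ₁)) (affinePoint (S *ᵥ circleVec φ₂)) := by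
  have hsin : 0 < Real.sin ((φ₂ - φ₁) / 2) :=
    Real.sin_pos_of_pos_of_lt_pi (by linarith [hφ.1]) (by linarith [hφ.2, hφ.1])
  have hcos : 0 < Real.cos ((φ₂ - φ₁) / 2) :=
    Real.cos_pos_of_mem_Ioo ⟨by linarith [hφ.1, hφ.2], by linarith [hφ.2]⟩
  have hne : affinePoint (S *ᵥ circleVec φ₂) ≠ affinePoint (S *ᵥ circleVec φ₁) := by
    intro h
    obtain ⟨k, hk, hk'⟩ := hS.cross_circlePoint φ₁ φ₂ (x := ![0, 0, 1]) (hS.pos _ (by simp)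
      (by simp))
    rw [h, triple_circleVec, sub_self] at hk'
    simp [cross, hk.ne', hsin.ne', hcos.ne'] at hk'
  refine ⟨hS.circlePoint_mem φ₂, hne, hS.existsUnique_tangent hC₁ h₁₂ h₂₃ hν hne htan,
    fun p hp => ?_⟩
  obtain ⟨x, hx, hx₂, -⟩ := hS.exists_coordinates (hS.quadForm_neg h₁₂ h₂₃ hν hp).le
  have hp' : quadForm (ν₁ • C₁ + ν₂ • C₂) ![p.1, p.2, 1] = 0 := hp
  have hpx : p = affinePoint (S *ᵥ x) := by rw [hx]; simp [affinePoint]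
  rw [← hx, hS.quadForm_pencil] at hp'
  obtain ⟨k, hk, hk'⟩ := hS.cross_circlePoint φ₁ φ₂ (x := x) (by simp [hx])
  rw [hpx, hk', triple_circleVec]
  refine mul_nonneg hk.le (mul_nonneg (by positivity) (sub_nonneg.2 ?_))
  refine le_of_abs_le (abs_le_of_sq_le_sq ?_ (by positivity))
  have hp₂ : φ₂ + φ₁ = 2 * ((φ₂ + φ₁) / 2) := by ring
  have hq₂ : φ₂ - φ₁ = 2 * ((φ₂ - φ₁) / 2) := by ring
  rw [hp₂, hq₂, Real.cos_two_mul, Real.cos_two_mul] at htan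
  obtain ⟨hν₂, hc⟩ := hν
  have ha : 0 < ν₁ + l₁ * ν₂ := by nlinarith
  have hb : 0 < ν₁ + l₂ * ν₂ := by nlinarith
  have t := Real.sin_sq_add_cos_sq ((φ₂ + φ₁) / 2)
  generalize Real.cos ((φ₂ - φ₁) / 2) = y at *
  generalize Real.cos ((φ₂ + φ₁) / 2) = u at *
  generalize Real.sin ((φ₂ + φ₁) / 2) = v at *
  generalize ν₁ + l₁ * ν₂ = a at *
  generalize ν₁ + l₂ * ν₂ = b at *
  generalize ν₁ + l₃ * ν₂ = c at *
  refine le_of_mul_le_mul_left ?_ (mul_pos ha hb)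
  -- This is weighted Cauchy–Schwarz, (u x₀ + v x₁)² ≤ (u²/a + v²/b)(a x₀² + b x₁²), with its
  -- defect. Tangency and membership turn the right side into (y x₂)².
  have key : a * b * (y * x 2) ^ 2 - a * b * (u * x 0 + v * x 1) ^ 2 =
      (b * u * x 1 - a * v * x 0) ^ 2 := by
    linear_combination -(x 2 ^ 2 / 2) * htan - (b * u ^ 2 + a * v ^ 2) * hp' -
      a * c * x 2 ^ 2 * t
  nlinarith [sq_nonneg (b * u * x 1 - a * v * x 0)]

end IsPencilFrame

/-! ### The modulus and the rays of parameters -/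

theorem HasOrderedEigenvalues.pencilEccentricity_sq {A : Matrix (Fin 3) (Fin 3) ℝ}
    (h : HasOrderedEigenvalues A l₁ l₂ l₃) :
    pencilEccentricity l₁ l₂ l₃ ^ 2 = (l₁ - l₂) / (l₁ - l₃) :=
  Real.sq_sqrt (div_nonneg (sub_nonneg.2 h.lt₁₂.le) (sub_nonneg.2 (h.lt₂₃.trans h.lt₁₂).le))

theorem HasOrderedEigenvalues.pencilEccentricity_sq_lt_one {A : Matrix (Fin 3) (Fin 3) ℝ}
    (h : HasOrderedEigenvalues A l₁ l₂ l₃) : pencilEccentricity l₁ l₂ l₃ ^ 2 < 1 := by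
  rw [h.pencilEccentricity_sq, div_lt_one (sub_pos.2 (h.lt₂₃.trans h.lt₁₂))]
  linarith [h.lt₂₃]

/-- The ray `ν₁ / ν₂ = inverseRatio l₁ l₂ l₃ ℓ` in terms of the square of `cn (2 K ℓ)`. -/
theorem eq_inverseRatio_iff {e : ℝ} (he : e = pencilEccentricity l₁ l₂ l₃) (he₁ : e ^ 2 < 1)
    {ℓ : ℝ} (hℓ₀ : 0 < ℓ) (hℓ₁ : ℓ < 1 / 2) {ν₁ ν₂ : ℝ} (hν₂ : 0 < ν₂) :
    ν₁ / ν₂ = inverseRatio l₁ l₂ l₃ ℓ ↔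
      ν₁ + l₃ * ν₂ = Real.cos (jacobiAm (2 * ellipticK e * ℓ) e) ^ 2 * (ν₁ + l₁ * ν₂) := by
  have hK := ellipticK_pos he₁
  obtain ⟨h₀, h₁⟩ := jacobiAm_mem_Ioo he₁ (v := 2 * ellipticK e * ℓ) (by positivity)
    (by nlinarith)
  have hs : 0 < Real.sin (jacobiAm (2 * ellipticK e * ℓ) e) :=
    Real.sin_pos_of_pos_of_lt_pi h₀ (by linarith)
  rw [inverseRatio, ← he, jacobiCn, jacobiSn, div_eq_div_iff hν₂.ne' (by positivity)]
  have t := Real.sin_sq_add_cos_sq (jacobiAm (2 * ellipticK e * ℓ) e)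
  constructor <;> intro h
  · linear_combination h - ν₁ * t
  · linear_combination h + ν₁ * t

/-- Validity puts c/a in (0, 1), so cn = √(c/a) is solved by an amplitude in (0, π/2), that is, by
some ℓ in (0, 1/2). -/
theorem exists_eq_inverseRatio {A : Matrix (Fin 3) (Fin 3) ℝ}
    (h : HasOrderedEigenvalues A l₁ l₂ l₃) {ν₁ ν₂ : ℝ} (hν : IsValidParameter l₃ ν₁ ν₂) :
    ∃ ℓ : ℝ, 0 < ℓ ∧ ℓ < 1 / 2 ∧ ν₁ / ν₂ = inverseRatio l₁ l₂ l₃ ℓ := by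
  have he := h.pencilEccentricity_sq_lt_one
  obtain ⟨e, hee⟩ : ∃ e, e = pencilEccentricity l₁ l₂ l₃ := ⟨_, rfl⟩
  rw [← hee] at he
  have hK := ellipticK_pos he
  have hlt : ν₁ + l₃ * ν₂ < ν₁ + l₁ * ν₂ := by
    linarith [mul_lt_mul_of_pos_right (h.lt₂₃.trans h.lt₁₂) hν.1]
  have ha := hν.2.trans hlt
  have hr₀ : 0 < (ν₁ + l₃ * ν₂) / (ν₁ + l₁ * ν₂) := div_pos hν.2 ha
  have hr₁ : (ν₁ + l₃ * ν₂) / (ν₁ + l₁ * ν₂) < 1 := (div_lt_one ha).2 hlt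
  have hsq : √((ν₁ + l₃ * ν₂) / (ν₁ + l₁ * ν₂)) < 1 := by
    rw [Real.sqrt_lt' one_pos]; simpa using hr₁
  have h₀ := strictMono_ellipticF he (Real.arccos_pos.2 hsq)
  have h₁ := strictMono_ellipticF he (Real.arccos_lt_pi_div_two.2 (Real.sqrt_pos.2 hr₀))
  simp only [ellipticF_zero] at h₀ h₁
  change _ < ellipticK e at h₁
  have h₂ : ellipticF (Real.arccos √((ν₁ + l₃ * ν₂) / (ν₁ + l₁ * ν₂))) e / (2 * ellipticK e) <
      1 / 2 := by
    rw [div_lt_div_iff₀ (by positivity) two_pos]; linarith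
  refine ⟨_, div_pos h₀ (by positivity), h₂, ?_⟩
  rw [eq_inverseRatio_iff hee he (div_pos h₀ (by positivity)) h₂ hν.1,
    mul_div_cancel₀ _ (by positivity), jacobiAm_ellipticF he,
    Real.cos_arccos (by linarith [Real.sqrt_nonneg ((ν₁ + l₃ * ν₂) / (ν₁ + l₁ * ν₂))]) hsq.le,
    Real.sq_sqrt hr₀.le, div_mul_cancel₀ _ ha.ne']

theorem isValidParameter_of_eq_inverseRatio {A : Matrix (Fin 3) (Fin 3) ℝ}
    (h : HasOrderedEigenvalues A l₁ l₂ l₃) {ℓ : ℝ} (hℓ₀ : 0 < ℓ) (hℓ₁ : ℓ < 1 / 2)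
    {ν₁ ν₂ : ℝ} (hν₂ : 0 < ν₂) (hν : ν₁ / ν₂ = inverseRatio l₁ l₂ l₃ ℓ) :
    IsValidParameter l₃ ν₁ ν₂ := by
  have he := h.pencilEccentricity_sq_lt_one
  rw [eq_inverseRatio_iff rfl he hℓ₀ hℓ₁ hν₂] at hν
  generalize pencilEccentricity l₁ l₂ l₃ = e at *
  have hK := ellipticK_pos he
  obtain ⟨h₀, h₁⟩ := jacobiAm_mem_Ioo he (v := 2 * ellipticK e * ℓ) (by positivity)
    (by nlinarith)
  have hs : 0 < Real.sin (jacobiAm (2 * ellipticK e * ℓ) e) :=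
    Real.sin_pos_of_pos_of_lt_pi h₀ (by linarith)
  have hc : 0 < Real.cos (jacobiAm (2 * ellipticK e * ℓ) e) :=
    Real.cos_pos_of_mem_Ioo ⟨by linarith, h₁⟩
  have t := Real.sin_sq_add_cos_sq (jacobiAm (2 * ellipticK e * ℓ) e)
  generalize Real.cos (jacobiAm (2 * ellipticK e * ℓ) e) = c at *
  generalize Real.sin (jacobiAm (2 * ellipticK e * ℓ) e) = s at *
  refine ⟨hν₂, pos_of_mul_pos_right (a := s ^ 2) ?_ (sq_nonneg s)⟩
  have hl : 0 < l₁ - l₃ := sub_pos.2 (h.lt₂₃.trans h.lt₁₂)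
  have : s ^ 2 * (ν₁ + l₃ * ν₂) = c ^ 2 * ((l₁ - l₃) * ν₂) := by
    linear_combination hν + (ν₁ + l₃ * ν₂) * t
  rw [this]
  positivity

/-! ### The Poncelet map as a translation -/

/-- The parametrization of the outer conic by the Jacobi amplitude. -/
noncomputable def jacobiParam (S : Matrix (Fin 3) (Fin 3) ℝ) (e t : ℝ) : ℝ × ℝ :=
  affinePoint (S *ᵥ circleVec (jacobiAm (4 * ellipticK e * t) e))

namespace IsPencilFrame

theorem isPositiveParametrization (hS : IsPencilFrame C₁ C₂ S l₁ l₂ l₃) {e : ℝ}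
    (he : e ^ 2 < 1) : IsPositiveParametrization (conic C₁) (jacobiParam S e) := by
  have hK := ellipticK_pos he
  have hadd (u : ℝ) : jacobiAm (4 * ellipticK e * (u + 1)) e =
      jacobiAm (4 * ellipticK e * u) e + 2 * Real.pi := by
    have : 4 * ellipticK e * (u + 1) =
        4 * ellipticK e * u + 2 * ellipticK e + 2 * ellipticK e := by ring
    rw [this, jacobiAm_add_two_mul_ellipticK he, jacobiAm_add_two_mul_ellipticK he]
    ring
  have hmono {a b : ℝ} (hab : a < b) :
      jacobiAm (4 * ellipticK e * a) e < jacobiAm (4 * ellipticK e * b) e :=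
    strictMono_jacobiAm he (mul_lt_mul_of_pos_left hab (by positivity))
  refine ⟨?_, fun t => ?_, ?_, fun a b c hab hbc hca => ?_⟩
  · have hc : Continuous fun t => jacobiAm (4 * ellipticK e * t) e :=
      (continuous_jacobiAm he).comp (continuous_const.mul continuous_id)
    have hv : Continuous fun t => S *ᵥ circleVec (jacobiAm (4 * ellipticK e * t) e) := by
      refine Continuous.matrix_mulVec continuous_const (continuous_pi fun i => ?_)
      fin_cases i
      exacts [Real.continuous_cos.comp hc, Real.continuous_sin.comp hc, continuous_const]
    have hv (i : Fin 3) := (continuous_apply i).comp hv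
    exact ((hv 0).div (hv 2) fun t => (hS.circleVec_pos _).ne').prodMk
      ((hv 1).div (hv 2) fun t => (hS.circleVec_pos _).ne')
  · simp only [jacobiParam, hadd, circleVec, Real.cos_add_two_pi, Real.sin_add_two_pi]
  · refine Set.Subset.antisymm ?_ fun p hp => ?_
    · rintro _ ⟨t, rfl⟩
      exact hS.circlePoint_mem _
    · obtain ⟨φ, rfl⟩ := hS.exists_circlePoint_eq hp
      refine ⟨ellipticF φ e / (4 * ellipticK e), ?_⟩
      rw [jacobiParam, mul_div_cancel₀ _ (by positivity), jacobiAm_ellipticF he]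
  · obtain ⟨k, hk, hk'⟩ := hS.cross_circlePoint (jacobiAm (4 * ellipticK e * a) e)
      (jacobiAm (4 * ellipticK e * b) e) (hS.circleVec_pos (jacobiAm (4 * ellipticK e * c) e))
    simp only [jacobiParam]
    rw [hk']
    have := hmono hca
    rw [hadd] at this
    exact mul_pos hk (triple_circleVec_pos (hmono hab) (hmono hbc) this)

/-- In the parametrization by the Jacobi amplitude the Poncelet map is a translation. -/
theorem isPonceletStep_jacobiParam (hS : IsPencilFrame C₁ C₂ S l₁ l₂ l₃)
    (h : StandingAssumptions C₁ C₂ l₁ l₂ l₃) {ℓ : ℝ} (hℓ₀ : 0 < ℓ) (hℓ₁ : ℓ < 1 / 2)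
    {ν₁ ν₂ : ℝ} (hν : IsValidParameter l₃ ν₁ ν₂) (hℓ : ν₁ / ν₂ = inverseRatio l₁ l₂ l₃ ℓ)
    (t : ℝ) :
    IsPonceletStep (conic C₁) (conic (ν₁ • C₁ + ν₂ • C₂))
      (jacobiParam S (pencilEccentricity l₁ l₂ l₃) t)
      (jacobiParam S (pencilEccentricity l₁ l₂ l₃) (ℓ + t)) := by
  have he := h.eigenvalues.pencilEccentricity_sq_lt_one
  have hsq := h.eigenvalues.pencilEccentricity_sq
  have h₁₂ := h.eigenvalues.lt₁₂
  have h₂₃ := h.eigenvalues.lt₂₃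
  rw [eq_inverseRatio_iff rfl he hℓ₀ hℓ₁ hν.1] at hℓ
  generalize pencilEccentricity l₁ l₂ l₃ = e at *
  have hK := ellipticK_pos he
  have hv₀ : 0 < 2 * ellipticK e * ℓ := by positivity
  have hv₁ : 2 * ellipticK e * ℓ < ellipticK e := by nlinarith
  -- The chord from t to ℓ + t is centred at u = 4Kt + 2Kℓ with half-step v = 2Kℓ.
  have e₁ : 4 * ellipticK e * t = 4 * ellipticK e * t + 2 * ellipticK e * ℓ -
    2 * ellipticK e * ℓ := by ring
  have e₂ : 4 * ellipticK e * (ℓ + t) = 4 * ellipticK e * t + 2 * ellipticK e * ℓ +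
    2 * ellipticK e * ℓ := by ring
  rw [jacobiParam, jacobiParam, e₂, e₁, sub_add_cancel]
  have hadd := one_add_cos_jacobiAm_sub he hv₀ hv₁ (4 * ellipticK e * t + 2 * ellipticK e * ℓ)
  -- Here the modulus matters: e² (l₁ - l₃) = l₁ - l₂ turns c = cn² v · a into b = dn² v · a.
  have hΔ : ellipticDelta (jacobiAm (2 * ellipticK e * ℓ) e) e ^ 2 * (ν₁ + l₁ * ν₂) =
      ν₁ + l₂ * ν₂ := by
    rw [ellipticDelta_sq he]
    rw [eq_div_iff (by linarith)] at hsq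
    have s := Real.sin_sq_add_cos_sq (jacobiAm (2 * ellipticK e * ℓ) e)
    linear_combination -e ^ 2 * (ν₁ + l₁ * ν₂) * s - e ^ 2 * hℓ - ν₂ * hsq
  refine hS.isPonceletStep h.signature₁ h₁₂ h₂₃ hν (jacobiAm_sub_mem_Ioo he hv₀ hv₁ _) ?_
  rw [← hΔ, hℓ]
  linear_combination -(ν₁ + l₁ * ν₂) ^ 2 * hadd

end IsPencilFrame

end Frame

/-! ### The Poncelet map and its rotation number -/

section Main

variable {C₁ C₂ : Matrix (Fin 3) (Fin 3) ℝ} {l₁ l₂ l₃ : ℝ}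

theorem StandingAssumptions.existsUnique_isPonceletStep
    (h : StandingAssumptions C₁ C₂ l₁ l₂ l₃) {ν₁ ν₂ : ℝ} (hν : IsValidParameter l₃ ν₁ ν₂)
    {z : ℝ × ℝ} (hz : z ∈ conic C₁) :
    ∃! w, IsPonceletStep (conic C₁) (conic (ν₁ • C₁ + ν₂ • C₂)) z w := by
  obtain ⟨S, hS⟩ := h.exists_isPencilFrame
  obtain ⟨ℓ, hℓ₀, hℓ₁, hℓ⟩ := exists_eq_inverseRatio h.eigenvalues hν
  have hγ := hS.isPositiveParametrization h.eigenvalues.pencilEccentricity_sq_lt_one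
  obtain ⟨t, rfl⟩ := hγ.range_eq.symm ▸ hz
  have hst := hS.isPonceletStep_jacobiParam h hℓ₀ hℓ₁ hν hℓ t
  exact ⟨_, hst, fun w hw => hw.unique h.signature₁
    (fun p hp => hS.quadForm_neg h.eigenvalues.lt₁₂ h.eigenvalues.lt₂₃ hν hp) hz hst⟩

theorem StandingAssumptions.hasRotationNumber
    (h : StandingAssumptions C₁ C₂ l₁ l₂ l₃) {ℓ : ℝ} (hℓ₀ : 0 < ℓ) (hℓ₁ : ℓ < 1 / 2)
    {ν₁ ν₂ : ℝ} (hν : IsValidParameter l₃ ν₁ ν₂)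
    (hℓ : ν₁ / ν₂ = inverseRatio l₁ l₂ l₃ ℓ) :
    HasRotationNumber (conic C₁) (ponceletMap (conic C₁) (conic (ν₁ • C₁ + ν₂ • C₂)))
      (ℓ : UnitAddCircle) := by
  obtain ⟨S, hS⟩ := h.exists_isPencilFrame
  have hγ := hS.isPositiveParametrization h.eigenvalues.pencilEccentricity_sq_lt_one
  refine ⟨_, hγ, CircleDeg1Lift.translate (Multiplicative.ofAdd ℓ), ?_, fun t => ?_, ?_⟩
  · have : ⇑(CircleDeg1Lift.translate (Multiplicative.ofAdd ℓ) : CircleDeg1Lift) =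
        fun t => ℓ + t := funext fun t => CircleDeg1Lift.translate_apply ℓ t
    rw [this]
    fun_prop
  · rw [CircleDeg1Lift.translate_apply]
    have hst := hS.isPonceletStep_jacobiParam h hℓ₀ hℓ₁ hν hℓ t
    exact (h.existsUnique_isPonceletStep hν (hγ.range_eq ▸ Set.mem_range_self t)).unique
      (Classical.epsilon_spec ⟨_, hst⟩) hst
  · rw [CircleDeg1Lift.translationNumber_translate]

end Main
end Poncelet

theorem mainTheorem5 (C₁ C₂ : Matrix (Fin 3) (Fin 3) ℝ) (l₁ l₂ l₃ : ℝ)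
    (h : Poncelet.StandingAssumptions C₁ C₂ l₁ l₂ l₃) (ℓ : ℝ) (hℓ₀ : 0 < ℓ) (hℓ₁ : ℓ < 1 / 2) :
    (∀ ν₁ ν₂ : ℝ, 0 < ν₂ → ν₁ / ν₂ = Poncelet.inverseRatio l₁ l₂ l₃ ℓ →
      Poncelet.IsValidParameter l₃ ν₁ ν₂) ∧
    ∀ ν₁ ν₂ : ℝ, Poncelet.IsValidParameter l₃ ν₁ ν₂ →
      (∀ z ∈ Poncelet.conic C₁,
        ∃! w, Poncelet.IsPonceletStep (Poncelet.conic C₁)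
          (Poncelet.conic (ν₁ • C₁ + ν₂ • C₂)) z w) ∧
      (Poncelet.HasRotationNumber (Poncelet.conic C₁)
          (Poncelet.ponceletMap (Poncelet.conic C₁) (Poncelet.conic (ν₁ • C₁ + ν₂ • C₂)))
          (ℓ : UnitAddCircle) ↔
        ν₁ / ν₂ = Poncelet.inverseRatio l₁ l₂ l₃ ℓ) := by
  refine ⟨fun ν₁ ν₂ hν₂ hν =>
    Poncelet.isValidParameter_of_eq_inverseRatio h.eigenvalues hℓ₀ hℓ₁ hν₂ hν,
    fun ν₁ ν₂ hν => ⟨fun z hz => h.existsUnique_isPonceletStep hν hz,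
      fun hrot => ?_, fun hℓ => h.hasRotationNumber hℓ₀ hℓ₁ hν hℓ⟩⟩
  obtain ⟨ℓ', hℓ₀', hℓ₁', hℓ'⟩ := Poncelet.exists_eq_inverseRatio h.eigenvalues hν
  have heq := hrot.unique (h.hasRotationNumber hℓ₀' hℓ₁' hν hℓ')
  -- Both numbers lie in [0, 1), so equality modulo 1 is equality.
  rw [AddCircle.coe_eq_coe_iff_of_mem_Ico (a := 0) ⟨hℓ₀.le, by linarith⟩
    ⟨hℓ₀'.le, by linarith⟩] at heq
  rw [heq, hℓ']
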